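/- Let $\mathfrak S_n$ be the symmetric group on $\{1,\dots,n\}$, let $S$ be its set of adjacent transpositions $s_i=(i,i+1)$, and let $\ell$ be the word length with respect to $S$. For $w,w'\in\mathfrak S_n$ write $w\to w'$ if there is a (possibly trivial) sequence $w=w_1,\dots,w_{k+1}=w'$ such that for each $i$ one has $w_{i+1}=sw_is$ and $\ell(w_{i+1})\le\ell(w_i)$ for some $s\in S$; write $w\approx w'$ if $w\to w'$ and $w'\to w$. A composition $\alpha=(\alpha_1,\dots,\alpha_l)$ of $n$ is called maximal if there is $0\le j\le l$ such that $\alpha_1,\dots,\alpha_j$ are even, $\alpha_{j+1},\dots,\alpha_l$ are odd and $\alpha_{j+1}\ge\dots\ge\alpha_l$. For a composition $\alpha$ of $n$ let $(x_1,\dots,x_n)=(1,n,2,n-1,\dots)$, that is $x_{2i-1}=i$ and $x_{2i}=n-i+1$, cut this list into consecutive pieces of lengths $\alpha_1,\dots,\alpha_l$, and let $\sigma_\alpha\in\mathfrak S_n$ be the product of the $l$ cycles given by these pieces (the element in stair form). For maximal $\alpha$ let $\Sigma_\alpha$ be the $\approx$-equivalence class of $\sigma_\alpha$. Let $\alpha=(\alpha_1,\dots,\alpha_l)$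 be a maximal composition of $n$ with even parts $\alpha_1,\dots,\alpha_j$ and composition of odd parts $\alpha'=(\alpha_{j+1},\dots,\alpha_l)$, which may be empty, and let $n'=\alpha_{j+1}+\dots+\alpha_l$. Put $P=\{i\le j:\alpha_i\ge4\}$, $p=|P|$ and $q=-2p+\frac12\sum_{i\in P}\alpha_i$. Then $q$ is a nonnegative integer and $$|\Sigma_\alpha|=2^p\,3^q\,|\Sigma_{\alpha'}|.$$ Moreover, suppose that $\alpha'$ is a hook $(r,1^{n'-r})$ with $1\le r\le n'$, or that $\alpha'$ is empty, in which case put $r=0$. Then $$|\Sigma_\alpha|=\begin{cases}2^p\,3^q&\text{if } r\le1,\\ (n'-r+1)\,2^{p+1}\,3^{\,q+(r-3)/2}&\text{if } r\ge3.\end{cases}$$ -/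

import Mathlib

namespace HeckeCenter

/-- The least number of factors in a word for `w` whose letters lie in `S`. -/
noncomputable def wordLength {W : Type*} [Group W] (S : Set W) (w : W) : ℕ :=
  sInf {k | ∃ l : List W, l.length = k ∧ (∀ s ∈ l, s ∈ S) ∧ l.prod = w}

/-- One cyclic shift `w → s w s` with `s ∈ S` that does not increase the length. -/
def CyclicShiftStep {W : Type*} [Group W] (S : Set W) (w w' : W) : Prop :=
  ∃ s ∈ S, w' = s * w * s ∧ wordLength S w' ≤ wordLength S w

/-- The cyclic shift relation `w → w'`. -/
def CyclicShift {W : Type*} [Group W] (S : Set W) : W → W → Prop :=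
  Relation.ReflTransGen (CyclicShiftStep S)

/-- The equivalence relation `w ≈ w'`: both `w → w'` and `w' → w`. -/
def CyclicShiftEquiv {W : Type*} [Group W] (S : Set W) (w w' : W) : Prop :=
  CyclicShift S w w' ∧ CyclicShift S w' w

/-- The Coxeter generators of the symmetric group: the adjacent transpositions. -/
def adjacentTranspositions (n : ℕ) : Set (Equiv.Perm (Fin n)) :=
  {s | ∃ (i : ℕ) (hi : i + 1 < n), s = Equiv.swap ⟨i, Nat.lt_of_succ_lt hi⟩ ⟨i + 1, hi⟩}

/-- The composition consists of even parts, followed by weakly decreasing odd parts. -/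
def IsMaximal {n : ℕ} (α : Composition n) : Prop :=
  ∃ k ≤ α.blocks.length, (∀ a ∈ α.blocks.take k, Even a) ∧
    (∀ a ∈ α.blocks.drop k, Odd a) ∧ (α.blocks.drop k).Pairwise (· ≥ ·)

/-- The `k`-th entry of the list `(1, n, 2, n - 1, …)`. Positions and entries are both counted
from zero here, so that the list reads `(0, n - 1, 1, n - 2, …)`. -/
def stairEntry (n : ℕ) (k : Fin n) : Fin n :=
  if Even (k : ℕ) then ⟨k / 2, by omega⟩ else ⟨n - 1 - k / 2, by omega⟩

/-- The list `(0, n - 1, 1, n - 2, …)` of length `n`. -/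
def stairList (n : ℕ) : List (Fin n) := List.ofFn (stairEntry n)

/-- The element in stair form `σ_α`: cut the list `(0, n - 1, 1, n - 2, …)` into consecutive
pieces whose lengths are the parts of `α`, and take the product of the corresponding cycles. -/
def stairForm {n : ℕ} (α : Composition n) : Equiv.Perm (Fin n) :=
  ((α.blocks.splitLengths (stairList n)).map List.formPerm).prod

/-- The class `Σ_α` of the element in stair form under the relation `≈`. -/
def stairClass {n : ℕ} (α : Composition n) : Set (Equiv.Perm (Fin n)) :=
  {w | CyclicShiftEquiv (adjacentTranspositions n) w (stairForm α)}

/-- The composition `α'` formed by the odd parts of `α`, in their order. -/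
def oddParts {n : ℕ} (α : Composition n) :
    Composition (α.blocks.filter (fun a => Odd a)).sum where
  blocks := α.blocks.filter (fun a => Odd a)
  blocks_pos := fun h => α.blocks_pos (List.mem_of_mem_filter h)
  blocks_sum := rfl

/-- The set `P` of the positions of those even parts of `α` that are at least `4`. -/
def largeEvenPositions {n : ℕ} (α : Composition n) : Finset (Fin α.length) :=
  Finset.univ.filter (fun i => Even (α.blocksFun i) ∧ 4 ≤ α.blocksFun i)

/-- `α = (r, 1^{m - r})` with `1 ≤ r ≤ m`, or `r = m = 0` and `α` is the empty composition. -/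
def HasHookForm {m : ℕ} (α : Composition m) (r : ℕ) : Prop :=
  (1 ≤ r ∧ r ≤ m ∧ α.blocks = r :: List.replicate (m - r) 1) ∨ (r = 0 ∧ α.blocks = [])

end HeckeCenter

namespace HeckeCenter

/-! Length is the number of inversions, so within a class every nontrivial step is a conjugation by
a transposition `s` of neighbours in which one of the two multiplications by `s` raises the length
and the other lowers it. `ShiftAllowed` expresses this as opposite comparisons: the images of the
two neighbours are ordered one way, their preimages the other way. These steps are reversible, so a
class is a connected component, and the theorem counts it.

If the first part is `2 * (K + 2)`, the first cycle of the stair form lives on the `K + 2` smallest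
and the `K + 2` largest points, and the remaining parts form a stair element on the interval in
between. Every shape this cycle can take is built from the inside to the outside: start from the two
innermost entries in one of two orders, and place each further pair (next smaller point, next larger
point) before, after or around the list obtained so far (`arc`). Rotating the cycle brings the
outermost pair to the front, so `K` pairs remain free and there are `2 * 3 ^ K` shapes.

Two facts carry the count. Shapes are closed under allowed shifts, and a shift acts either on the
cycle or on the inner interval, never on both (`ArcCycle.shift`). Every shape can be shifted to the
one in which all free pairs are placed around, with a fixed orientation, without moving an inner
point (`ArcCycle.conn_true`). Hence the class is the product of the set of shapes and the class of
the inner permutation (`OuterCycles.ncard_shiftClass`). A part `2` admits only one shape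
(`outerCycles_pair`).

For a hook `(2 * K + 3, 1, …, 1)` the same description holds with a single innermost entry, which
may sit at any point of the middle interval while the other points there are fixed. This gives the
additional factor (number of parts `1`) + 1 in `stairCount_hook`. -/

open Equiv

/-! ### Length as number of inversions, and the shifts that preserve it -/

/-- The condition on `w` under which conjugation by the transposition of two neighbours `x` and `y`
changes `w` but preserves its length. -/
def ShiftAllowed {L : Type*} [LinearOrder L] (w : Perm L) (x y : L) : Prop :=
  (w x < w y ∧ w⁻¹ y < w⁻¹ x) ∨ (w y < w x ∧ w⁻¹ x < w⁻¹ y)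

/-- The inversions of a permutation. -/
def inversions {n : ℕ} (w : Perm (Fin n)) : Finset (Fin n × Fin n) :=
  Finset.univ.filter fun p => p.1 < p.2 ∧ w p.2 < w p.1

@[simp]
theorem mem_inversions {n : ℕ} {w : Perm (Fin n)} {p q : Fin n} :
    (p, q) ∈ inversions w ↔ p < q ∧ w q < w p := by
  simp [inversions]

theorem inversions_one {n : ℕ} : inversions (1 : Perm (Fin n)) = ∅ := by
  ext ⟨p, q⟩
  simpa using fun h : p < q => h.le

/-- Nothing lies strictly between neighbours, so exchanging them reverses the order of no other
pair. -/
theorem swap_lt_swap {n : ℕ} {x y p q : Fin n} (hxy : (y : ℕ) = x + 1) (hpq : p < q)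
    (hne : ¬ (p = x ∧ q = y)) : swap x y p < swap x y q := by
  rw [swap_apply_def, swap_apply_def]
  simp only [Fin.ext_iff, Fin.lt_def] at *
  split_ifs <;> omega

/-- Applying the swap to both coordinates carries the inversions of `w` to inversions of the
product; the only one missed is `(x, y)`. -/
theorem card_inversions_mul_swap {n : ℕ} {x y : Fin n} (hxy : (y : ℕ) = x + 1)
    (w : Perm (Fin n)) (h : w x < w y) :
    (inversions (w * swap x y)).card = (inversions w).card + 1 := by
  have hlt : x < y := by rw [Fin.lt_def]; omega
  have e : inversions (w * swap x y) =
      insert (x, y) ((inversions w).image (Prod.map (swap x y) (swap x y))) := by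
    ext ⟨p, q⟩
    simp only [mem_inversions, Perm.mul_apply, Finset.mem_insert, Finset.mem_image, Prod.exists, Prod.map_apply, Prod.mk.injEq]
    constructor
    · rintro ⟨h1, h2⟩
      by_cases hne : p = x ∧ q = y
      · exact Or.inl hne
      · exact Or.inr ⟨_, _, ⟨swap_lt_swap hxy h1 hne, h2⟩, by simp, by simp⟩
    · rintro (⟨rfl, rfl⟩ | ⟨a, b, ⟨h1, h2⟩, rfl, rfl⟩)
      · simpa using ⟨hlt, h⟩
      · refine ⟨swap_lt_swap hxy h1 ?_, by simpa using h2⟩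
        rintro ⟨rfl, rfl⟩
        exact lt_asymm h h2
  rw [e, Finset.card_insert_of_notMem, Finset.card_image_of_injective]
  · exact (Equiv.injective _).prodMap (Equiv.injective _)
  · simp only [mem_inversions, Finset.mem_image, Prod.exists, Prod.map_apply, Prod.mk.injEq, not_exists, not_and]
    rintro a b ⟨h1, -⟩ h3 h4
    rw [swap_apply_eq_iff, swap_apply_left] at h3
    rw [swap_apply_eq_iff, swap_apply_right] at h4
    subst h3 h4
    exact lt_asymm h1 hlt

theorem card_inversions_inv {n : ℕ} (w : Perm (Fin n)) :
    (inversions w⁻¹).card = (inversions w).card := by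
  refine Finset.card_bij' (fun p _ => (w⁻¹ p.2, w⁻¹ p.1)) (fun p _ => (w p.2, w p.1)) ?_ ?_ ?_ ?_
  all_goals simp +contextual [inversions]

theorem card_inversions_swap_mul {n : ℕ} {x y : Fin n} (hxy : (y : ℕ) = x + 1)
    (w : Perm (Fin n)) (h : w⁻¹ x < w⁻¹ y) :
    (inversions (swap x y * w)).card = (inversions w).card + 1 := by
  rw [← card_inversions_inv, mul_inv_rev, swap_inv, card_inversions_mul_swap hxy _ h,
    card_inversions_inv]

/-- Without a descent `w` would be an order automorphism of `Fin n`, and the identity is the only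
one. -/
theorem exists_descent {n : ℕ} (w : Perm (Fin n)) (hw : w ≠ 1) :
    ∃ (i : ℕ) (hi : i + 1 < n), w ⟨i + 1, hi⟩ < w ⟨i, Nat.lt_of_succ_lt hi⟩ := by
  by_contra! hcon
  apply hw
  have hm : StrictMono w := by
    cases n with
    | zero => exact fun a => a.elim0
    | succ m =>
      refine Fin.strictMono_iff_lt_succ.2 fun i => lt_of_le_of_ne (hcon i (by omega)) ?_
      exact fun h => absurd (w.injective h) (by simp [Fin.ext_iff])
  have := Subsingleton.elim (hm.orderIsoOfSurjective w w.surjective) (OrderIso.refl (Fin n))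
  ext x
  exact congrArg Fin.val (DFunLike.congr_fun this x)

theorem exists_word {n : ℕ} (w : Perm (Fin n)) : ∃ l : List (Perm (Fin n)),
    l.length = (inversions w).card ∧ (∀ s ∈ l, s ∈ adjacentTranspositions n) ∧ l.prod = w := by
  induction hk : (inversions w).card using Nat.strong_induction_on generalizing w with
  | _ k ih =>
    by_cases hw : w = 1
    · subst hw
      exact ⟨[], by simp [← hk, inversions_one], by simp, by simp⟩
    · obtain ⟨i, hi, h⟩ := exists_descent w hw
      set s := swap (⟨i, Nat.lt_of_succ_lt hi⟩ : Fin n) ⟨i + 1, hi⟩ with hs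
      have h1 := card_inversions_mul_swap (x := ⟨i, Nat.lt_of_succ_lt hi⟩) (y := ⟨i + 1, hi⟩) rfl
        (w * s) (by simpa [hs] using h)
      rw [mul_assoc, ← hs, swap_mul_self, mul_one, hk] at h1
      obtain ⟨l, hl, hl', hp⟩ := ih _ (by omega) (w * s) rfl
      refine ⟨l ++ [s], by simp [hl, h1], ?_, by simp [hp, mul_assoc, hs]⟩
      intro t ht
      rcases List.mem_append.1 ht with ht | ht
      · exact hl' t ht
      · rw [List.mem_singleton.1 ht]
        exact ⟨i, hi, rfl⟩

theorem card_inversions_prod_le {n : ℕ} (l : List (Perm (Fin n)))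
    (hl : ∀ s ∈ l, s ∈ adjacentTranspositions n) :
    (inversions l.prod).card ≤ l.length := by
  induction l with
  | nil => simp [inversions_one]
  | cons s l ih =>
    obtain ⟨i, hi, rfl⟩ := hl s (by simp)
    have ih := ih fun t ht => hl t (by simp [ht])
    rw [List.prod_cons, List.length_cons]
    rcases lt_or_ge (l.prod⁻¹ ⟨i, Nat.lt_of_succ_lt hi⟩) (l.prod⁻¹ ⟨i + 1, hi⟩) with h | h
    · rw [card_inversions_swap_mul rfl _ h]
      omega
    · have h' := lt_of_le_of_ne h fun h => absurd (Equiv.injective _ h) (by simp [Fin.ext_iff])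
      have := card_inversions_swap_mul (x := ⟨i, Nat.lt_of_succ_lt hi⟩) (y := ⟨i + 1, hi⟩) rfl
        (swap ⟨i, Nat.lt_of_succ_lt hi⟩ ⟨i + 1, hi⟩ * l.prod) (by simpa [mul_inv_rev] using h')
      rw [← mul_assoc, swap_mul_self, one_mul] at this
      omega

theorem wordLength_eq_card_inversions {n : ℕ} (w : Perm (Fin n)) :
    wordLength (adjacentTranspositions n) w = (inversions w).card := by
  apply le_antisymm
  · exact Nat.sInf_le (exists_word w)
  · refine le_csInf ⟨_, exists_word w⟩ ?_
    rintro k ⟨l, rfl, hl, rfl⟩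
    exact card_inversions_prod_le l hl

/-- One cyclic shift between permutations of equal length, for the neighbours `x` and `y`. -/
def FinShiftStep {n : ℕ} (w w' : Perm (Fin n)) : Prop :=
  ∃ x y : Fin n, (y : ℕ) = x + 1 ∧ ShiftAllowed w x y ∧ w' = swap x y * w * swap x y

theorem swap_lt_swap_of_shiftAllowed {n : ℕ} {x y : Fin n} (hxy : (y : ℕ) = x + 1)
    {w : Perm (Fin n)} (h : w x < w y) (h' : w⁻¹ y < w⁻¹ x) :
    swap x y (w⁻¹ y) < swap x y (w⁻¹ x) := by
  refine swap_lt_swap hxy h' ?_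
  rintro ⟨h1, h2⟩
  rw [Perm.inv_eq_iff_eq] at h1 h2
  rw [← h1, ← h2, Fin.lt_def] at h
  omega

theorem swap_lt_swap_of_shiftAllowed' {n : ℕ} {x y : Fin n} (hxy : (y : ℕ) = x + 1)
    {w : Perm (Fin n)} (h : w y < w x) (h' : w⁻¹ x < w⁻¹ y) :
    swap x y (w⁻¹ x) < swap x y (w⁻¹ y) := by
  refine swap_lt_swap hxy h' ?_
  rintro ⟨h1, h2⟩
  rw [Perm.inv_eq_iff_eq] at h1 h2
  rw [← h1, ← h2, Fin.lt_def] at h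
  omega

theorem card_inversions_of_shiftAllowed {n : ℕ} {x y : Fin n} (hxy : (y : ℕ) = x + 1)
    {w : Perm (Fin n)} (h : ShiftAllowed w x y) :
    (inversions (swap x y * w * swap x y)).card = (inversions w).card := by
  rcases h with ⟨h, h'⟩ | ⟨h, h'⟩
  · have h1 := card_inversions_mul_swap hxy w h
    have h2 := card_inversions_swap_mul hxy (swap x y * (w * swap x y))
      (by simpa [mul_inv_rev] using swap_lt_swap_of_shiftAllowed hxy h h')
    rw [← mul_assoc, swap_mul_self, one_mul] at h2
    rw [mul_assoc]
    omega
  · have h1 := card_inversions_mul_swap hxy (w * swap x y) (by simpa using h)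
    have h2 := card_inversions_swap_mul hxy (w * swap x y)
      (by simpa [mul_inv_rev] using swap_lt_swap_of_shiftAllowed' hxy h h')
    rw [mul_assoc, swap_mul_self, mul_one] at h1
    rw [mul_assoc]
    omega

/-- If the shift is not allowed, both multiplications change the length in the same direction, by 2
in total, unless conjugation does nothing. -/
theorem shiftAllowed_of_card_inversions {n : ℕ} {x y : Fin n} (hxy : (y : ℕ) = x + 1)
    {w : Perm (Fin n)} (h : (inversions (swap x y * w * swap x y)).card = (inversions w).card)
    (hne : swap x y * w * swap x y ≠ w) : ShiftAllowed w x y := by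
  have hxy' : x ≠ y := fun h => by rw [h] at hxy; omega
  -- If `w` fixes both neighbours or exchanges them, it commutes with the swap. These are exactly
  -- the cases in which the second multiplication would undo the change of length made by the first.
  have hfix : w x ≠ x ∨ w y ≠ y := by
    by_contra! hcon
    exact hne (by rw [mul_assoc, mul_swap_eq_swap_mul, hcon.1, hcon.2, ← mul_assoc, swap_mul_self,
      one_mul])
  have hfix' : w x ≠ y ∨ w y ≠ x := by
    by_contra! hcon
    exact hne (by rw [mul_assoc, mul_swap_eq_swap_mul, hcon.1, hcon.2, ← mul_assoc, swap_comm y x,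
      swap_mul_self, one_mul])
  by_contra hcon
  have hw : w x ≠ w y := fun h => hxy' (w.injective h)
  have hw' : w⁻¹ x ≠ w⁻¹ y := fun h => hxy' (Equiv.injective _ h)
  simp only [ShiftAllowed, not_or, not_and, not_lt] at hcon
  rcases lt_or_gt_of_ne hw with h1 | h1
  · have h2 := lt_of_le_of_ne (hcon.1 h1) hw'
    have h3 := card_inversions_mul_swap hxy w h1
    have h4 := card_inversions_swap_mul hxy (w * swap x y)
      (by
        have := swap_lt_swap hxy h2 fun h => by
          rw [Perm.inv_eq_iff_eq, Perm.inv_eq_iff_eq] at h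
          exact hfix.elim (fun h' => h' h.1.symm) fun h' => h' h.2.symm
        simpa [mul_inv_rev] using this)
    rw [← mul_assoc] at h4
    omega
  · have h2 := lt_of_le_of_ne (hcon.2 h1) hw'.symm
    have h3 := card_inversions_mul_swap hxy (w * swap x y) (by simpa using h1)
    have h4 := card_inversions_swap_mul hxy (swap x y * (w * swap x y))
      (by
        have := swap_lt_swap hxy h2 fun h => by
          rw [Perm.inv_eq_iff_eq, Perm.inv_eq_iff_eq] at h
          exact hfix'.elim (fun h' => h' h.1.symm) fun h' => h' h.2.symm
        simpa [mul_inv_rev] using this)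
    rw [← mul_assoc, swap_mul_self, one_mul] at h4
    rw [mul_assoc, swap_mul_self, mul_one] at h3
    rw [mul_assoc] at h
    omega

/-- Length cannot increase along `→`, so it is constant along a chain that can be reversed. Steps
that change nothing are dropped from the chain. -/
theorem cyclicShift_iff_of_card_inversions {n : ℕ} {v w : Perm (Fin n)} :
    CyclicShiftEquiv (adjacentTranspositions n) w v ↔ Relation.ReflTransGen FinShiftStep v w := by
  have hle : ∀ {v w : Perm (Fin n)}, CyclicShift (adjacentTranspositions n) v w →
      (inversions w).card ≤ (inversions v).card := by
    intro v w h
    induction h with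
    | refl => exact le_rfl
    | tail _ h ih =>
      obtain ⟨s, -, -, h⟩ := h
      rw [wordLength_eq_card_inversions, wordLength_eq_card_inversions] at h
      exact h.trans ih
  have hsteps : ∀ {v w : Perm (Fin n)}, CyclicShift (adjacentTranspositions n) v w →
      (inversions v).card ≤ (inversions w).card → Relation.ReflTransGen FinShiftStep v w := by
    intro v w h
    induction h with
    | refl => exact fun _ => .refl
    | @tail b c h1 h2 ih =>
      intro hvc
      have hbv := hle h1
      have hcb := hle (.single h2)
      obtain ⟨s, ⟨i, hi, rfl⟩, rfl, -⟩ := h2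
      refine (ih (hvc.trans hcb)).trans ?_
      by_cases hne : swap ⟨i, Nat.lt_of_succ_lt hi⟩ ⟨i + 1, hi⟩ * b *
          swap ⟨i, Nat.lt_of_succ_lt hi⟩ ⟨i + 1, hi⟩ = b
      · rw [hne]
      · exact .single ⟨_, _, rfl,
          shiftAllowed_of_card_inversions rfl (hcb.antisymm (hbv.trans hvc)) hne, rfl⟩
  constructor
  · exact fun h => hsteps h.2 (hle h.1)
  · intro h
    induction h with
    | refl => exact ⟨.refl, .refl⟩
    | tail _ h ih =>
      obtain ⟨x, y, hxy, h, rfl⟩ := h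
      have hs : swap x y ∈ adjacentTranspositions n :=
        ⟨x, by omega, congrArg (swap x) (Fin.ext hxy)⟩
      have hc := card_inversions_of_shiftAllowed hxy h
      rw [← wordLength_eq_card_inversions, ← wordLength_eq_card_inversions] at hc
      exact ⟨.head ⟨_, hs, by simp [mul_assoc], hc.ge⟩ ih.1, ih.2.tail ⟨_, hs, rfl, hc.le⟩⟩

/-! ### Transfer to permutations of intervals of natural numbers -/

/-- One cyclic shift preserving the length, by a transposition of neighbours in `[a, b)`. -/
def ShiftStep (a b : ℕ) (w w' : Perm ℕ) : Prop :=
  ∃ i, a ≤ i ∧ i + 1 < b ∧ ShiftAllowed w i (i + 1) ∧ w' = swap i (i + 1) * w * swap i (i + 1)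

/-- The permutations reached from `w` by cyclic shifts in `[a, b)` that preserve the length. -/
def shiftClass (a b : ℕ) (w : Perm ℕ) : Set (Perm ℕ) :=
  {w' | Relation.ReflTransGen (ShiftStep a b) w w'}

theorem swap_succ_lt_swap_succ {i p q : ℕ} (hpq : p < q) (hne : ¬ (p = i ∧ q = i + 1)) :
    swap i (i + 1) p < swap i (i + 1) q := by
  rw [swap_apply_def, swap_apply_def]
  split_ifs <;> omega

/-- Conjugation interchanges the two alternatives of `ShiftAllowed`; this makes shifts reversible.
-/
theorem ShiftAllowed.conj {w : Perm ℕ} {i : ℕ} (h : ShiftAllowed w i (i + 1)) :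
    ShiftAllowed (swap i (i + 1) * w * swap i (i + 1)) i (i + 1) := by
  have aux : ∀ {w : Perm ℕ}, w i < w (i + 1) → w⁻¹ (i + 1) < w⁻¹ i →
      swap i (i + 1) (w i) < swap i (i + 1) (w (i + 1)) ∧
        swap i (i + 1) (w⁻¹ (i + 1)) < swap i (i + 1) (w⁻¹ i) := by
    intro w h h'
    constructor
    · refine swap_succ_lt_swap_succ h fun h1 => ?_
      rw [← Perm.eq_inv_iff_eq, ← Perm.eq_inv_iff_eq] at h1
      omega
    · refine swap_succ_lt_swap_succ h' fun h1 => ?_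
      rw [Perm.inv_eq_iff_eq, Perm.inv_eq_iff_eq] at h1
      omega
  rcases h with ⟨h, h'⟩ | ⟨h, h'⟩
  · have := aux h h'
    right
    simpa [mul_inv_rev] using this
  · have := aux (w := w⁻¹) h' (by simpa using h)
    left
    simpa [mul_inv_rev, and_comm] using this

theorem ShiftStep.symm {a b : ℕ} {w w' : Perm ℕ} (h : ShiftStep a b w w') :
    ShiftStep a b w' w := by
  obtain ⟨i, h1, h2, h3, rfl⟩ := h
  exact ⟨i, h1, h2, h3.conj, by simp [mul_assoc]⟩

theorem reflTransGen_shiftStep_symm {a b : ℕ} {w w' : Perm ℕ}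
    (h : Relation.ReflTransGen (ShiftStep a b) w w') :
    Relation.ReflTransGen (ShiftStep a b) w' w :=
  have : Std.Symm (ShiftStep a b) := ⟨fun _ _ => ShiftStep.symm⟩
  Std.Symm.symm _ _ h

/-- The embedding of `Fin n` as the interval `[a, a + n)`. -/
def offsetEmbedding (a n : ℕ) : Fin n ↪ ℕ :=
  ⟨fun x => a + x, fun x y h => Fin.ext (by simpa using h)⟩

/-- A permutation of `Fin n` as a permutation of `[a, a + n)`. -/
noncomputable def offsetPerm (a n : ℕ) : Perm (Fin n) →* Perm ℕ :=
  Perm.viaEmbeddingHom (offsetEmbedding a n)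

theorem offsetPerm_injective (a n : ℕ) : Function.Injective (offsetPerm a n) :=
  Perm.viaEmbeddingHom_injective _

@[simp]
theorem offsetPerm_add {a n : ℕ} (w : Perm (Fin n)) (x : Fin n) :
    offsetPerm a n w (a + x) = a + w x :=
  Perm.viaEmbedding_apply w (offsetEmbedding a n) x

theorem offsetPerm_of_notMem {a n : ℕ} (w : Perm (Fin n)) {z : ℕ} (hz : z < a ∨ a + n ≤ z) :
    offsetPerm a n w z = z := by
  refine Perm.viaEmbedding_apply_of_notMem w (offsetEmbedding a n) z ?_
  rintro ⟨x, rfl⟩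
  have := x.2
  change a + (x : ℕ) < a ∨ a + n ≤ a + (x : ℕ) at hz
  omega

theorem offsetPerm_ext {a n : ℕ} {w : Perm (Fin n)} {v : Perm ℕ}
    (h : ∀ x : Fin n, v (a + x) = a + w x) (h' : ∀ z, z < a ∨ a + n ≤ z → v z = z) :
    offsetPerm a n w = v := by
  ext z
  by_cases hz : z < a ∨ a + n ≤ z
  · rw [offsetPerm_of_notMem w hz, h' z hz]
  · obtain ⟨x, rfl⟩ : ∃ x : Fin n, z = a + x := ⟨⟨z - a, by omega⟩, by simp; omega⟩
    rw [offsetPerm_add, h]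

theorem offsetPerm_swap {a n : ℕ} (x y : Fin n) :
    offsetPerm a n (swap x y) = swap (a + x : ℕ) (a + y) := by
  apply offsetPerm_ext
  · intro z
    simp only [swap_apply_def, Nat.add_left_cancel_iff, Fin.ext_iff]
    split_ifs <;> rfl
  · intro z hz
    exact swap_apply_of_ne_of_ne (by omega) (by omega)

theorem offsetPerm_formPerm {a n : ℕ} (l : List (Fin n)) :
    offsetPerm a n l.formPerm = (l.map fun x : Fin n => a + (x : ℕ)).formPerm := by
  induction l with
  | nil => simp
  | cons x l ih =>
    cases l with
    | nil => simp
    | cons y l =>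
      rw [List.formPerm_cons_cons, map_mul, ih, offsetPerm_swap]
      simp only [List.map_cons,
        List.formPerm_cons_cons]

theorem shiftAllowed_offsetPerm {a n : ℕ} {w : Perm (Fin n)} {x y : Fin n} :
    ShiftAllowed (offsetPerm a n w) (a + x : ℕ) (a + y) ↔ ShiftAllowed w x y := by
  simp only [ShiftAllowed, ← map_inv, offsetPerm_add, Nat.add_lt_add_iff_left, Fin.lt_def]

theorem shiftClass_offsetPerm {a n : ℕ} (v : Perm (Fin n)) :
    shiftClass a (a + n) (offsetPerm a n v) =
      offsetPerm a n '' {w | Relation.ReflTransGen FinShiftStep v w} := by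
  ext w
  constructor
  · intro h
    induction (h : Relation.ReflTransGen (ShiftStep a (a + n)) (offsetPerm a n v) w) with
    | refl => exact ⟨v, .refl, rfl⟩
    | tail h1 h2 ih =>
      obtain ⟨u, hu, rfl⟩ := ih
      obtain ⟨i, hi, hi', h3, rfl⟩ := h2
      obtain ⟨x, rfl⟩ : ∃ x : Fin n, i = a + x := ⟨⟨i - a, by omega⟩, by simp; omega⟩
      obtain ⟨y, hy⟩ : ∃ y : Fin n, a + (x : ℕ) + 1 = a + y :=
        ⟨⟨x + 1, by omega⟩, by simp; omega⟩
      rw [hy] at h3 ⊢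
      exact ⟨_, Relation.ReflTransGen.tail hu
        ⟨x, y, by omega, shiftAllowed_offsetPerm.1 h3, rfl⟩, by simp [offsetPerm_swap]⟩
  · rintro ⟨u, hu, rfl⟩
    induction (hu : Relation.ReflTransGen FinShiftStep v u) with
    | refl => exact .refl
    | tail h1 h2 ih =>
      refine Relation.ReflTransGen.tail (ih) ?_
      obtain ⟨x, y, hxy, h3, rfl⟩ := h2
      have hy : a + (x : ℕ) + 1 = a + y := by omega
      refine ⟨a + x, by omega, by omega, ?_, ?_⟩
      · rw [hy]
        exact shiftAllowed_offsetPerm.2 h3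
      · rw [hy, map_mul, map_mul, offsetPerm_swap]

/-- Free choice of the offset `a` is what later allows the permutation left inside an outer cycle to
be recognised as a smaller stair form. -/
theorem ncard_stairClass {n : ℕ} (α : Composition n) (a : ℕ) :
    (stairClass α).ncard = (shiftClass a (a + n) (offsetPerm a n (stairForm α))).ncard := by
  rw [shiftClass_offsetPerm, Set.ncard_image_of_injective _ (offsetPerm_injective a n)]
  simp only [stairClass, cyclicShift_iff_of_card_inversions]

/-! ### Stair forms on intervals -/

/-- The list `(a, a + n - 1, a + 1, …)` of length `n`. -/
def stairs : ℕ → ℕ → List ℕ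
  | _, 0 => []
  | a, 1 => [a]
  | a, n + 2 => a :: (a + n + 1) :: stairs (a + 1) n

/-- The product of the cycles cut out of the list `(a, a + n - 1, a + 1, …)` by the list `l`. -/
noncomputable def stairPerm (a : ℕ) (l : List ℕ) : Perm ℕ :=
  ((l.splitLengths (stairs a l.sum)).map List.formPerm).prod

theorem length_stairs (a n : ℕ) : (stairs a n).length = n := by
  fun_induction stairs a n <;> simp_all

theorem getElem_stairs (a n k : ℕ) (hk : k < n) :
    (stairs a n)[k]'(by rwa [length_stairs]) =
      a + if Even k then k / 2 else n - 1 - k / 2 := by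
  fun_induction stairs a n generalizing k with
  | case1 => omega
  | case2 => obtain rfl : k = 0 := by omega
             simp [stairs]
  | case3 a n ih =>
    match k with
    | 0 => simp [stairs]
    | 1 => simp [stairs]; omega
    | k + 2 =>
      simp only [stairs, List.getElem_cons_succ]
      rw [ih k (by omega)]
      have : Even (k + 2) ↔ Even k := by simp [Nat.even_add]
      simp only [this]
      split_ifs <;> omega

theorem map_stairList (a n : ℕ) : (stairList n).map (fun x : Fin n => a + (x : ℕ)) = stairs a n := by
  apply List.ext_getElem
  · simp [stairList, length_stairs]
  · intro k h1 h2
    have hk : k < n := by rwa [length_stairs] at h2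
    rw [getElem_stairs a n k hk]
    simp only [stairList, List.getElem_map, List.getElem_ofFn, stairEntry]
    split_ifs <;> rfl

theorem map_splitLengths {β γ : Type*} (f : β → γ) (l : List ℕ) (s : List β) :
    (l.splitLengths s).map (List.map f) = l.splitLengths (s.map f) := by
  induction l generalizing s with
  | nil => simp
  | cons k l ih => simp [ih]

theorem offsetPerm_stairForm {n : ℕ} (α : Composition n) (a : ℕ) :
    offsetPerm a n (stairForm α) = stairPerm a α.blocks := by
  rw [stairForm, stairPerm, α.blocks_sum, map_list_prod, ← map_stairList, ← map_splitLengths,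
    List.map_map, List.map_map]
  refine congrArg List.prod (List.map_congr_left fun l _ => ?_)
  exact offsetPerm_formPerm l

/-- The number of elements of the class of the element in stair form, for the list of parts `l`. -/
noncomputable def stairCount (l : List ℕ) : ℕ :=
  (shiftClass 0 l.sum (stairPerm 0 l)).ncard

theorem ncard_stairClass_eq_stairCount {n : ℕ} (α : Composition n) :
    (stairClass α).ncard = stairCount α.blocks := by
  rw [ncard_stairClass α 0, offsetPerm_stairForm, stairCount, α.blocks_sum, Nat.zero_add]

theorem ncard_shiftClass_stairPerm {l : List ℕ} (hl : ∀ k ∈ l, 0 < k) (a : ℕ) :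
    (shiftClass a (a + l.sum) (stairPerm a l)).ncard = stairCount l := by
  let α : Composition l.sum := ⟨l, fun h => hl _ h, rfl⟩
  rw [← ncard_stairClass_eq_stairCount α, ncard_stairClass α a, offsetPerm_stairForm]

theorem stairPerm_mem_Ico {l : List ℕ} (hl : ∀ k ∈ l, 0 < k) {a z : ℕ}
    (hz : z < a ∨ a + l.sum ≤ z) : stairPerm a l z = z := by
  let α : Composition l.sum := ⟨l, fun h => hl _ h, rfl⟩
  have := offsetPerm_stairForm α a
  rw [← this, offsetPerm_of_notMem _ hz]

/-! ### Pieces of cycles as paths -/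

/-- The permutation `w` maps `u` to the first entry of the list, every entry of the list to the next
one, and the last entry to `v`. -/
def IsPath (w : Perm ℕ) : ℕ → List ℕ → ℕ → Prop
  | u, [], v => w u = v
  | u, x :: l, v => w u = x ∧ IsPath w x l v

@[simp]
theorem isPath_nil {w : Perm ℕ} {u v : ℕ} : IsPath w u [] v ↔ w u = v := Iff.rfl

@[simp]
theorem isPath_cons {w : Perm ℕ} {u x v : ℕ} {l : List ℕ} :
    IsPath w u (x :: l) v ↔ w u = x ∧ IsPath w x l v := Iff.rfl

@[simp]
theorem isPath_append_cons {w : Perm ℕ} {u x v : ℕ} {l l' : List ℕ} :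
    IsPath w u (l ++ x :: l') v ↔ IsPath w u l x ∧ IsPath w x l' v := by
  induction l generalizing u with
  | nil => simp
  | cons y l ih => simp [ih, and_assoc]

theorem IsPath.conj {w : Perm ℕ} {u v : ℕ} {l : List ℕ} (h : IsPath w u l v) (g : Perm ℕ) :
    IsPath (g * w * g⁻¹) (g u) (l.map g) (g v) := by
  induction l generalizing u with
  | nil => simpa using h
  | cons x l ih => exact ⟨by simp [h.1], ih h.2⟩

theorem IsPath.congr {w w' : Perm ℕ} {u v : ℕ} {l : List ℕ} (h : IsPath w u l v)
    (hu : w' u = w u) (hl : ∀ z ∈ l, w' z = w z) : IsPath w' u l v := by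
  induction l generalizing u with
  | nil => exact hu.trans h
  | cons x l ih =>
    exact ⟨hu.trans h.1, ih h.2 (hl x (by simp)) fun z hz => hl z (by simp [hz])⟩

theorem IsPath.apply_eq {w w' : Perm ℕ} {u v : ℕ} {l : List ℕ} (h : IsPath w u l v)
    (h' : IsPath w' u l v) : ∀ z ∈ u :: l, w z = w' z := by
  induction l generalizing u with
  | nil => simpa using Eq.trans h (Eq.symm h')
  | cons x l ih =>
    intro z hz
    rcases List.mem_cons.1 hz with rfl | hz
    · exact h.1.trans h'.1.symm
    · exact ih h.2 h'.2 z hz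

theorem IsPath.eq_of_length_eq {w : Perm ℕ} {u v v' : ℕ} {l l' : List ℕ} (h : IsPath w u l v)
    (h' : IsPath w u l' v') (hl : l.length = l'.length) : l = l' := by
  induction l generalizing u l' with
  | nil => exact (List.length_eq_zero_iff.1 hl.symm).symm
  | cons x l ih =>
    cases l' with
    | nil => simp at hl
    | cons x' l' =>
      obtain rfl : x = x' := h.1.symm.trans h'.1
      rw [ih h.2 h'.2 (by simpa using hl)]

theorem IsPath.exists_ends {w : Perm ℕ} {u v : ℕ} {l : List ℕ} (h : IsPath w u l v) (hl : l ≠ [])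
    {P : ℕ → Prop} (hP : ∀ z ∈ l, P z) : ∃ a b, P a ∧ P b ∧ w u = a ∧ w b = v := by
  obtain ⟨x, l', rfl⟩ := List.exists_cons_of_ne_nil hl
  refine ⟨x, (x :: l').getLast hl, hP x (by simp), hP _ (List.getLast_mem hl), h.1, ?_⟩
  rw [← List.dropLast_append_getLast hl] at h
  exact (isPath_append_cons.1 h).2

theorem isPath_formPerm {x : ℕ} {l : List ℕ} (h : (x :: l).Nodup) :
    IsPath (x :: l).formPerm x l x := by
  have : ∀ (s : List ℕ) (z : ℕ) (r : List ℕ), s ++ z :: r = x :: l →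
      IsPath (x :: l).formPerm z r x := by
    intro s z r
    induction r generalizing s z with
    | nil =>
      intro e
      have := List.formPerm_apply_getLast x l
      simp only [← e] at this ⊢
      simpa using this
    | cons y r ih =>
      intro e
      refine ⟨?_, ih (s ++ [z]) y (by simpa using e)⟩
      have := List.formPerm_apply_lt_getElem (x :: l) h s.length (by simp [← e])
      simpa [← e] using this
  exact this [] x l rfl

/-- With images and preimages given as plain numbers, whether a shift is allowed becomes linear
arithmetic on the neighbouring entries of a path. -/
theorem shiftAllowed_iff {w : Perm ℕ} {x y a b a' b' : ℕ} (hb : w x = b) (hb' : w y = b')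
    (ha : w a = x) (ha' : w a' = y) :
    ShiftAllowed w x y ↔ (b < b' ∧ a' < a) ∨ (b' < b ∧ a < a') := by
  rw [ShiftAllowed, ← Perm.inv_eq_iff_eq.2 ha.symm, ← Perm.inv_eq_iff_eq.2 ha'.symm, hb, hb']

/-! ### Arcs: lists built by nesting pairs -/

/-- The three ways of placing a pair of entries next to a list. -/
inductive Side
  | before
  | after
  | around

instance : Fintype Side :=
  ⟨⟨([Side.before, Side.after, Side.around] : List Side), by simp⟩, fun x => by cases x <;> simp⟩

/-- The innermost part of an arc: two entries, or a single given one. -/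
def arcCore : Option ℕ → Bool → ℕ → ℕ → List ℕ
  | none, true, lo, hi => [lo, hi]
  | none, false, lo, hi => [hi, lo]
  | some m, _, _, _ => [m]

/-- The list built from the inside to the outside by placing the pairs `lo, hi`. -/
def arc (c : Option ℕ) : Bool → List Side → ℕ → ℕ → List ℕ
  | o, [], lo, hi => arcCore c o lo hi
  | true, .before :: l, lo, hi => lo :: hi :: arc c true l (lo + 1) (hi - 1)
  | false, .before :: l, lo, hi => hi :: lo :: arc c false l (lo + 1) (hi - 1)
  | true, .after :: l, lo, hi => arc c true l (lo + 1) (hi - 1) ++ [lo, hi]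
  | false, .after :: l, lo, hi => arc c false l (lo + 1) (hi - 1) ++ [hi, lo]
  | true, .around :: l, lo, hi => lo :: (arc c false l (lo + 1) (hi - 1) ++ [hi])
  | false, .around :: l, lo, hi => hi :: (arc c true l (lo + 1) (hi - 1) ++ [lo])

/-- There is room for an arc with `k` pairs and the given core in `[lo, hi]`. -/
def ArcFits : Option ℕ → ℕ → ℕ → ℕ → Prop
  | none, k, lo, hi => lo + 2 * k < hi
  | some m, k, lo, hi => lo + k ≤ m ∧ m + k ≤ hi

theorem ArcFits.succ {c : Option ℕ} {k lo hi : ℕ} (h : ArcFits c (k + 1) lo hi) :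
    ArcFits c k (lo + 1) (hi - 1) ∧ lo + 2 ≤ hi := by
  cases c <;> simp only [ArcFits] at * <;> omega

theorem ArcFits.le {c : Option ℕ} {k lo hi : ℕ} (h : ArcFits c k lo hi) : lo + 2 * k ≤ hi := by
  cases c <;> simp only [ArcFits] at * <;> omega

theorem arc_ne_nil (c : Option ℕ) (o : Bool) (l : List Side) (lo hi : ℕ) :
    arc c o l lo hi ≠ [] := by
  rcases l with _ | ⟨_ | _ | _, l⟩ <;> cases o <;> cases c <;> simp [arc, arcCore]

/-- The set of entries depends neither on the orientation nor on the placements, only on the number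
of pairs: each pair uses up the two extreme points left. -/
theorem mem_arc {c : Option ℕ} {o : Bool} {l : List Side} {lo hi z : ℕ}
    (h : ArcFits c l.length lo hi) : z ∈ arc c o l lo hi ↔
      z ∈ arcCore c true (lo + l.length) (hi - l.length) ∨ (lo ≤ z ∧ z < lo + l.length) ∨
        (hi < z + l.length ∧ z ≤ hi) := by
  induction l generalizing o lo hi with
  | nil => cases o <;> cases c <;> simp [arc, arcCore] <;> omega
  | cons p l ih =>
    have h2 := h.succ
    have h3 := h.le
    have e1 : lo + 1 + l.length = lo + (l.length + 1) := by omega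
    have e2 : hi - 1 - l.length = hi - (l.length + 1) := by omega
    rcases p with _ | _ | _ <;> cases o
    all_goals
      simp only [arc, List.mem_cons, List.mem_append, ih h2.1, List.not_mem_nil, or_false,
        List.length_cons, e1, e2] at h3 ⊢
      generalize (z ∈ arcCore c true (lo + (l.length + 1)) (hi - (l.length + 1))) = Q
      by_cases hQ : Q <;> simp only [hQ, true_or, or_true, false_or]
      omega

theorem le_of_mem_arc {c : Option ℕ} {o : Bool} {l : List Side} {lo hi z : ℕ}
    (h : ArcFits c l.length lo hi) (hz : z ∈ arc c o l lo hi) : lo ≤ z ∧ z ≤ hi := by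
  rw [mem_arc h] at hz
  cases c <;> simp only [ArcFits, arcCore, List.mem_cons, List.not_mem_nil, or_false] at h hz <;>
    omega

theorem length_arc (c : Option ℕ) (o : Bool) (l : List Side) (lo hi : ℕ) :
    (arc c o l lo hi).length = (arcCore c true 0 0).length + 2 * l.length := by
  induction l generalizing o lo hi with
  | nil => cases o <;> cases c <;> simp [arc, arcCore]
  | cons p l ih => rcases p with _ | _ | _ <;> cases o <;> simp [arc, ih] <;> omega

theorem nodup_arc {c : Option ℕ} {o : Bool} {l : List Side} {lo hi : ℕ}
    (h : ArcFits c l.length lo hi) : (arc c o l lo hi).Nodup := by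
  induction l generalizing o lo hi with
  | nil => cases o <;> cases c <;> simp [arc, arcCore, ArcFits] at * <;> omega
  | cons p l ih =>
    have h2 := h.succ
    have h3 : ∀ o, lo ∉ arc c o l (lo + 1) (hi - 1) := fun o hz => by
      have := le_of_mem_arc h2.1 hz
      omega
    have h4 : ∀ o, hi ∉ arc c o l (lo + 1) (hi - 1) := fun o hz => by
      have := le_of_mem_arc h2.1 hz
      omega
    have h5 : lo ≠ hi := by omega
    rcases p with _ | _ | _ <;> cases o <;>
      simp [arc, List.nodup_append, ih h2.1, h3, h4, h5, h5.symm]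
    all_goals
      intro z hz
      have := le_of_mem_arc h2.1 hz
      omega

/-- The inner arc starts with neither `lo` nor `hi`. So the first entry detects `after`, and the
second entry separates `before` from `around`; the rest is induction. -/
theorem arc_injective {c : Option ℕ} {o : Bool} {l l' : List Side} {lo hi : ℕ}
    (h : ArcFits c l.length lo hi) (hl : l.length = l'.length)
    (he : arc c o l lo hi = arc c o l' lo hi) : l = l' := by
  induction l generalizing o l' lo hi with
  | nil => exact (List.length_eq_zero_iff.1 hl.symm).symm
  | cons p l ih =>
    cases l' with
    | nil => simp at hl
    | cons q l' =>
      have hl' : l.length = l'.length := by simpa using hl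
      have h2 := h.succ
      have h2' := h2.1
      rw [hl'] at h2'
      have aux : ∀ o, ∃ z s, arc c o l (lo + 1) (hi - 1) = z :: s ∧ z ≠ lo ∧ z ≠ hi := by
        intro o
        obtain ⟨z, s, e⟩ := List.exists_cons_of_ne_nil (arc_ne_nil c o l (lo + 1) (hi - 1))
        have := le_of_mem_arc (z := z) (o := o) h2.1 (by simp [e])
        exact ⟨z, s, e, by omega, by omega⟩
      have aux' : ∀ o, ∃ z s, arc c o l' (lo + 1) (hi - 1) = z :: s ∧ z ≠ lo ∧ z ≠ hi := by
        intro o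
        obtain ⟨z, s, e⟩ := List.exists_cons_of_ne_nil (arc_ne_nil c o l' (lo + 1) (hi - 1))
        have := le_of_mem_arc (z := z) (o := o) h2' (by simp [e])
        exact ⟨z, s, e, by omega, by omega⟩
      obtain ⟨z1, s1, e1, n1, n1'⟩ := aux true
      obtain ⟨z2, s2, e2, n2, n2'⟩ := aux false
      obtain ⟨z3, s3, e3, n3, n3'⟩ := aux' true
      obtain ⟨z4, s4, e4, n4, n4'⟩ := aux' false
      have i1 := ih (o := true) h2.1 hl'
      have i2 := ih (o := false) h2.1 hl'
      rw [e1, e3, List.cons.injEq] at i1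
      rw [e2, e4, List.cons.injEq] at i2
      rcases p with _ | _ | _ <;> rcases q with _ | _ | _ <;> cases o <;>
        simp only [arc, List.append_cancel_right_eq, List.cons.injEq, true_and, e1, e2, e3, e4,
          List.cons_append, reduceCtorEq, false_and] at he ⊢
      all_goals first
        | exact i1 he
        | exact i2 he
        | exact absurd he.1.symm (by assumption)
        | exact absurd he.1 (by assumption)

theorem map_swap_arc {c : Option ℕ} {o : Bool} {l : List Side} {lo hi x y : ℕ}
    (h : ArcFits c l.length lo hi) (hx : x < lo ∨ hi < x) (hy : y < lo ∨ hi < y) :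
    (arc c o l lo hi).map (swap x y) = arc c o l lo hi := by
  refine (List.map_congr_left (g := id) fun z hz => ?_).trans (List.map_id _)
  have := le_of_mem_arc h hz
  exact swap_apply_of_ne_of_ne (by omega) (by omega)

/-- The ends `u` and `v` of an arc with entries in `[lo, hi]` lie on different sides of it. -/
def ArcEnds : Bool → ℕ → ℕ → ℕ → ℕ → Prop
  | true, lo, hi, u, v => v < lo ∧ hi < u
  | false, lo, hi, u, v => u < lo ∧ hi < v

theorem IsPath.exists_arc_ends {c : Option ℕ} {w : Perm ℕ} {o : Bool} {l : List Side}
    {lo hi t t' : ℕ} (hf : ArcFits c l.length lo hi) (hw : IsPath w t (arc c o l lo hi) t') :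
    ∃ a b, (lo ≤ a ∧ a ≤ hi) ∧ (lo ≤ b ∧ b ≤ hi) ∧ w t = a ∧ w b = t' :=
  hw.exists_ends (arc_ne_nil _ _ _ _ _) fun _ hz => le_of_mem_arc hf hz

/-! ### Local moves on arcs -/

/-- Two nested pairs: an allowed shift of the two outer or of the two inner small (large) entries
gives an arc again. -/
theorem exists_map_arc_pair {c : Option ℕ} {w : Perm ℕ} {o : Bool} {p q : Side} {l : List Side}
    {lo hi u v i : ℕ} (hf : ArcFits c (l.length + 2) lo hi)
    (hw : IsPath w u (arc c o (p :: q :: l) lo hi) v) (huv : ArcEnds o lo hi u v)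
    (hi' : i = lo ∨ i + 1 = hi) (ha : ShiftAllowed w i (i + 1)) :
    ∃ p' q', (arc c o (p :: q :: l) lo hi).map (swap i (i + 1)) =
      arc c o (p' :: q' :: l) lo hi := by
  have hh := hf.le
  obtain ⟨h, rfl⟩ : ∃ h, hi = h + 2 := ⟨hi - 2, by omega⟩
  have hf2 := hf.succ.1.succ.1
  have eh : h + 2 - 1 = h + 1 := rfl
  have eh' : h + 1 - 1 = h := rfl
  simp only [eh, eh'] at hf2
  have hm : ∀ o, (arc c o l (lo + 1 + 1) h).map (swap i (i + 1)) = arc c o l (lo + 1 + 1) h :=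
    fun o => map_swap_arc hf2 (by omega) (by omega)
  -- The two possible transpositions, of the small or of the large entries, are reduced to their
  -- values on the four entries concerned. The transposition itself can then be made opaque before
  -- the case analysis.
  have key : ∀ {P : Prop},
      (ShiftAllowed w lo (lo + 1) → swap i (i + 1) lo = lo + 1 → swap i (i + 1) (lo + 1) = lo →
        swap i (i + 1) (h + 1) = h + 1 → swap i (i + 1) (h + 2) = h + 2 → P) →
      (ShiftAllowed w (h + 1) (h + 2) → swap i (i + 1) lo = lo →
        swap i (i + 1) (lo + 1) = lo + 1 →
        swap i (i + 1) (h + 1) = h + 2 → swap i (i + 1) (h + 2) = h + 1 → P) → P := by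
    intro P h1 h2
    rcases hi' with rfl | hi'
    · exact h1 ha (swap_apply_left _ _) (swap_apply_right _ _)
        (swap_apply_of_ne_of_ne (by omega) (by omega))
        (swap_apply_of_ne_of_ne (by omega) (by omega))
    · obtain rfl : i = h + 1 := by omega
      exact h2 ha (swap_apply_of_ne_of_ne (by omega) (by omega))
        (swap_apply_of_ne_of_ne (by omega) (by omega))
        (swap_apply_left _ _) (swap_apply_right _ _)
  clear hi' ha
  generalize swap i (i + 1) = g at *
  rcases p with _ | _ | _ <;> rcases q with _ | _ | _ <;> cases o <;>
    simp only [arc, ArcEnds, List.append_assoc, List.cons_append, List.nil_append,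
      isPath_append_cons, isPath_cons, isPath_nil, eh, eh'] at hw huv <;>
    casesm* _ ∧ _ <;>
    -- Of the inner arc only its first and last entries matter, and only the fact that they lie
    -- between the four outer entries.
    obtain ⟨a, b, ⟨_, _⟩, ⟨_, _⟩, _, _⟩ := IsPath.exists_arc_ends hf2 (by assumption) <;>
    refine key ?_ ?_ <;> intro ha s1 s2 s3 s4 <;>
    rw [shiftAllowed_iff (by assumption) (by assumption) (by assumption) (by assumption)] at ha <;>
    first
      | (exfalso; omega)
      | simp only [arc, List.map_cons, List.map_append, List.map_nil, eh, eh', s1, s2, s3, s4, hm]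
  all_goals first
    | (refine ⟨.around, .before, ?_⟩
       simp only [arc, eh, eh', List.append_assoc, List.cons_append, List.nil_append]; done)
    | (refine ⟨.around, .after, ?_⟩
       simp only [arc, eh, eh', List.append_assoc, List.cons_append, List.nil_append]; done)
    | (refine ⟨.around, .around, ?_⟩
       simp only [arc, eh, eh', List.append_assoc, List.cons_append, List.nil_append]; done)
    | (refine ⟨.before, .around, ?_⟩
       simp only [arc, eh, eh', List.append_assoc, List.cons_append, List.nil_append]; done)
    | (refine ⟨.after, .around, ?_⟩
       simp only [arc, eh, eh', List.append_assoc, List.cons_append, List.nil_append]; done)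
    | (refine ⟨.before, .after, ?_⟩
       simp only [arc, eh, eh', List.append_assoc, List.cons_append, List.nil_append]; done)
    | (refine ⟨.after, .before, ?_⟩
       simp only [arc, eh, eh', List.append_assoc, List.cons_append, List.nil_append]; done)

/-- A pair placed before or after commutes past a pair placed around in one shift, so `around` can
be moved outwards. -/
theorem exists_swap_arc_around {c : Option ℕ} {w : Perm ℕ} {o : Bool} {p : Side} {l : List Side}
    {lo hi u v : ℕ} (hf : ArcFits c (l.length + 2) lo hi)
    (hw : IsPath w u (arc c o (p :: .around :: l) lo hi) v) (huv : ArcEnds o lo hi u v)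
    (hp : p ≠ .around) : ∃ i, (i = lo ∨ i + 1 = hi) ∧ ShiftAllowed w i (i + 1) ∧
    (arc c o (p :: .around :: l) lo hi).map (swap i (i + 1)) =
      arc c o (.around :: p :: l) lo hi := by
  have hh := hf.le
  obtain ⟨h, rfl⟩ : ∃ h, hi = h + 2 := ⟨hi - 2, by omega⟩
  have hf2 := hf.succ.1.succ.1
  have eh : h + 2 - 1 = h + 1 := rfl
  have eh' : h + 1 - 1 = h := rfl
  simp only [eh, eh'] at hf2
  have key : ∀ {P : ℕ → Prop},
      (((∀ o, (arc c o l (lo + 1 + 1) h).map (swap lo (lo + 1)) = arc c o l (lo + 1 + 1) h) →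
        swap lo (lo + 1) lo = lo + 1 → swap lo (lo + 1) (lo + 1) = lo →
        swap lo (lo + 1) (h + 1) = h + 1 → swap lo (lo + 1) (h + 2) = h + 2 →
          ShiftAllowed w lo (lo + 1) ∧ P lo) ∨
      ((∀ o, (arc c o l (lo + 1 + 1) h).map (swap (h + 1) (h + 1 + 1)) =
          arc c o l (lo + 1 + 1) h) → swap (h + 1) (h + 1 + 1) lo = lo →
        swap (h + 1) (h + 1 + 1) (lo + 1) = lo + 1 →
        swap (h + 1) (h + 1 + 1) (h + 1) = h + 2 → swap (h + 1) (h + 1 + 1) (h + 2) = h + 1 →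
          ShiftAllowed w (h + 1) (h + 2) ∧ P (h + 1))) →
      ∃ i, (i = lo ∨ i + 1 = h + 2) ∧ ShiftAllowed w i (i + 1) ∧ P i := by
    rintro P (h1 | h1)
    · exact ⟨lo, Or.inl rfl, h1 (fun o => map_swap_arc hf2 (by omega) (by omega))
        (swap_apply_left _ _) (swap_apply_right _ _)
        (swap_apply_of_ne_of_ne (by omega) (by omega))
        (swap_apply_of_ne_of_ne (by omega) (by omega))⟩
    · exact ⟨h + 1, Or.inr rfl, h1 (fun o => map_swap_arc hf2 (by omega) (by omega))
        (swap_apply_of_ne_of_ne (by omega) (by omega))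
        (swap_apply_of_ne_of_ne (by omega) (by omega))
        (swap_apply_left _ _) (swap_apply_right _ _)⟩
  apply key
  clear key
  generalize swap lo (lo + 1) = g at *
  generalize swap (h + 1) (h + 1 + 1) = g' at *
  rcases p with _ | _ | _ <;> cases o <;> try exact absurd rfl hp
  all_goals
    simp only [arc, ArcEnds, List.append_assoc, List.cons_append, List.nil_append,
      isPath_append_cons, isPath_cons, isPath_nil, eh, eh'] at hw huv
    casesm* _ ∧ _
    obtain ⟨a, b, ⟨_, _⟩, ⟨_, _⟩, _, _⟩ := IsPath.exists_arc_ends hf2 (by assumption)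
    first
      | refine Or.inl fun hm s1 s2 s3 s4 => ⟨?_, ?_⟩
        · rw [shiftAllowed_iff (by assumption) (by assumption) (by assumption) (by assumption)]
          omega
        · simp only [arc, List.map_cons, List.map_append, List.map_nil, eh, eh', s1, s2, s3, s4, hm,
            List.append_assoc, List.cons_append, List.nil_append]
      | refine Or.inr fun hm s1 s2 s3 s4 => ⟨?_, ?_⟩
        · rw [shiftAllowed_iff (by assumption) (by assumption) (by assumption) (by assumption)]
          omega
        · simp only [arc, List.map_cons, List.map_append, List.map_nil, eh, eh', s1, s2, s3, s4, hm,
            List.append_assoc, List.cons_append, List.nil_append]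

/-- The image and the preimage of an end of the core lie both above or both below everything
strictly inside, so the comparisons never oppose each other. This keeps the cycle from mixing with
the inner permutation. -/
theorem not_shiftAllowed_arcCore_none {w : Perm ℕ} {o : Bool} {lo hi u v i : ℕ} (hf : lo < hi)
    (hw : IsPath w u (arcCore none o lo hi) v) (huv : ArcEnds o lo hi u v)
    (hs : ∀ z, lo < z → z < hi → (lo < w z ∧ w z < hi) ∧ lo < w⁻¹ z ∧ w⁻¹ z < hi)
    (hi' : i = lo ∨ i + 1 = hi) : ¬ ShiftAllowed w i (i + 1) := by
  intro ha
  obtain ⟨t, ht⟩ : ∃ t, w⁻¹ i = t := ⟨_, rfl⟩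
  obtain ⟨t', ht'⟩ : ∃ t, w⁻¹ (i + 1) = t := ⟨_, rfl⟩
  have h1 := hs i
  have h2 := hs (i + 1)
  rw [ht] at h1
  rw [ht'] at h2
  rw [Perm.inv_eq_iff_eq] at ht ht'
  rcases eq_or_ne (i + 1) hi with rfl | hne
  · rcases eq_or_ne lo i with rfl | hne'
    · cases o <;> simp only [arcCore, isPath_cons, isPath_nil, ArcEnds] at hw huv <;>
        casesm* _ ∧ _ <;>
        rw [shiftAllowed_iff (by assumption) (by assumption) (by assumption) (by assumption)]
          at ha <;> omega
    · have h1 := h1 (by omega) (by omega)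
      cases o <;> simp only [arcCore, isPath_cons, isPath_nil, ArcEnds] at hw huv <;>
        casesm* _ ∧ _ <;>
        rw [shiftAllowed_iff rfl (by assumption) ht.symm (by assumption)]
          at ha <;> omega
  · obtain rfl : i = lo := by omega
    have h2 := h2 (by omega) (by omega)
    cases o <;> simp only [arcCore, isPath_cons, isPath_nil, ArcEnds] at hw huv <;>
      casesm* _ ∧ _ <;>
      rw [shiftAllowed_iff (by assumption) rfl (by assumption) ht'.symm]
        at ha <;> omega

/-- Two neighbouring fixed points cannot be shifted, so an allowed shift has to move the core. -/
theorem exists_map_arcCore_some {w : Perm ℕ} {o : Bool} {lo hi m i : ℕ} (hm : lo ≤ m ∧ m ≤ hi)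
    (hs : ∀ z, lo ≤ z → z ≤ hi → z ≠ m → w z = z) (h1 : lo ≤ i) (h2 : i + 1 ≤ hi)
    (ha : ShiftAllowed w i (i + 1)) :
    ∃ m', (lo ≤ m' ∧ m' ≤ hi) ∧
      (arcCore (some m) o lo hi).map (swap i (i + 1)) = arcCore (some m') o lo hi := by
  rcases eq_or_ne m i with rfl | h3
  · exact ⟨m + 1, ⟨by omega, h2⟩, by simp [arcCore]⟩
  · rcases eq_or_ne m (i + 1) with rfl | h4
    · exact ⟨i, ⟨by omega, by omega⟩, by simp [arcCore]⟩
    · have e1 := hs i h1 (by omega) h3.symm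
      have e2 := hs (i + 1) (by omega) h2 h4.symm
      rw [shiftAllowed_iff e1 e2 e1 e2] at ha
      omega

theorem shiftAllowed_arcCore_some {w : Perm ℕ} {o : Bool} {lo hi u v m : ℕ}
    (hm : lo ≤ m ∧ m + 1 ≤ hi) (hw : IsPath w u [m] v) (huv : ArcEnds o lo hi u v)
    (hs : w (m + 1) = m + 1) : ShiftAllowed w m (m + 1) := by
  cases o <;> simp only [isPath_cons, isPath_nil, ArcEnds] at hw huv <;>
    casesm* _ ∧ _ <;>
    rw [shiftAllowed_iff (by assumption) (by assumption) (by assumption) (by assumption)] <;> omega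

theorem shiftAllowed_arcCore_some' {w : Perm ℕ} {o : Bool} {lo hi u v m : ℕ}
    (hm : lo ≤ m ∧ m + 1 ≤ hi) (hw : IsPath w u [m + 1] v) (huv : ArcEnds o lo hi u v)
    (hs : w m = m) : ShiftAllowed w m (m + 1) := by
  cases o <;> simp only [isPath_cons, isPath_nil, ArcEnds] at hw huv <;>
    casesm* _ ∧ _ <;>
    rw [shiftAllowed_iff (by assumption) (by assumption) (by assumption) (by assumption)] <;> omega

/-- With a core of two entries, `around` is one shift away from each of `before` and `after`, and
these are not adjacent to each other. -/
theorem exists_map_arc_single_none {w : Perm ℕ} {o : Bool} {p : Side}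
    {lo hi u v i : ℕ} (hf : lo + 2 < hi)
    (hw : IsPath w u (arc none o [p] lo hi) v) (huv : ArcEnds o lo hi u v)
    (hi' : i = lo ∨ i + 1 = hi) (ha : ShiftAllowed w i (i + 1)) :
    ∃ p', (arc none o [p] lo hi).map (swap i (i + 1)) = arc none o [p'] lo hi := by
  obtain ⟨h, rfl⟩ : ∃ h, hi = h + 2 := ⟨hi - 2, by omega⟩
  have eh : h + 2 - 1 = h + 1 := rfl
  have key : ∀ {P : Prop},
      (ShiftAllowed w lo (lo + 1) → swap i (i + 1) lo = lo + 1 → swap i (i + 1) (lo + 1) = lo →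
        swap i (i + 1) (h + 1) = h + 1 → swap i (i + 1) (h + 2) = h + 2 → P) →
      (ShiftAllowed w (h + 1) (h + 2) → swap i (i + 1) lo = lo →
        swap i (i + 1) (lo + 1) = lo + 1 →
        swap i (i + 1) (h + 1) = h + 2 → swap i (i + 1) (h + 2) = h + 1 → P) → P := by
    intro P h1 h2
    rcases hi' with rfl | hi'
    · exact h1 ha (swap_apply_left _ _) (swap_apply_right _ _)
        (swap_apply_of_ne_of_ne (by omega) (by omega))
        (swap_apply_of_ne_of_ne (by omega) (by omega))
    · obtain rfl : i = h + 1 := by omega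
      exact h2 ha (swap_apply_of_ne_of_ne (by omega) (by omega))
        (swap_apply_of_ne_of_ne (by omega) (by omega))
        (swap_apply_left _ _) (swap_apply_right _ _)
  clear hi' ha
  generalize swap i (i + 1) = g at *
  rcases p with _ | _ | _ <;> cases o <;>
    simp only [arc, arcCore, ArcEnds, List.cons_append, List.nil_append,
      isPath_cons, isPath_nil, eh] at hw huv <;>
    casesm* _ ∧ _ <;>
    refine key ?_ ?_ <;> intro ha s1 s2 s3 s4 <;>
    rw [shiftAllowed_iff (by assumption) (by assumption) (by assumption) (by assumption)] at ha <;>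
    first
      | (exfalso; omega)
      | simp only [arc, arcCore, List.map_cons, List.map_nil, eh, s1, s2, s3, s4,
          List.cons_append, List.nil_append]
  all_goals first
    | (refine ⟨.around, ?_⟩
       simp only [arc, arcCore, eh, List.cons_append, List.nil_append]; done)
    | (refine ⟨.before, ?_⟩
       simp only [arc, arcCore, eh, List.cons_append, List.nil_append]; done)
    | (refine ⟨.after, ?_⟩
       simp only [arc, arcCore, eh, List.cons_append, List.nil_append]; done)

/-- Exchanging `lo` or `hi` with a fixed point is never allowed, so the shift has to exchange it
with the core `m`. -/
theorem exists_map_arc_single_some {w : Perm ℕ} {o : Bool} {p : Side}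
    {lo hi u v i m : ℕ} (hf : lo + 1 ≤ m ∧ m + 1 ≤ hi)
    (hw : IsPath w u (arc (some m) o [p] lo hi) v) (huv : ArcEnds o lo hi u v)
    (hs : ∀ z, lo < z → z < hi → z ≠ m → w z = z)
    (hi' : i = lo ∨ i + 1 = hi) (ha : ShiftAllowed w i (i + 1)) :
    ∃ p', (arc (some m) o [p] lo hi).map (swap i (i + 1)) = arc (some m) o [p'] lo hi := by
  obtain ⟨h, rfl⟩ : ∃ h, hi = h + 1 := ⟨hi - 1, by omega⟩
  have key : ∀ {P : Prop},
      (ShiftAllowed w lo (lo + 1) → (w (lo + 1) = lo + 1 ∨ m = lo + 1 ∧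
        swap i (i + 1) lo = m ∧ swap i (i + 1) m = lo ∧ swap i (i + 1) (h + 1) = h + 1) → P) →
      (ShiftAllowed w h (h + 1) → (w h = h ∨ m = h ∧
        swap i (i + 1) lo = lo ∧ swap i (i + 1) m = h + 1 ∧ swap i (i + 1) (h + 1) = m) → P) →
      P := by
    intro P h1 h2
    rcases hi' with rfl | hi'
    · refine h1 ha ?_
      rcases eq_or_ne m (i + 1) with rfl | hne
      · exact Or.inr ⟨rfl, swap_apply_left _ _, swap_apply_right _ _,
          swap_apply_of_ne_of_ne (by omega) (by omega)⟩
      · exact Or.inl (hs _ (by omega) (by omega) hne.symm)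
    · obtain rfl : i = h := by omega
      refine h2 ha ?_
      rcases eq_or_ne m i with rfl | hne
      · exact Or.inr ⟨rfl, swap_apply_of_ne_of_ne (by omega) (by omega), swap_apply_left _ _,
          swap_apply_right _ _⟩
      · exact Or.inl (hs _ (by omega) (by omega) hne.symm)
  clear hi' ha hs
  generalize swap i (i + 1) = g at *
  rcases p with _ | _ | _ <;> cases o <;>
    simp only [arc, arcCore, ArcEnds, List.cons_append, List.nil_append,
      isPath_cons, isPath_nil] at hw huv <;>
    casesm* _ ∧ _ <;>
    refine key ?_ ?_ <;> rintro ha (hx | ⟨rfl, s1, s2, s3⟩) <;>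
    rw [shiftAllowed_iff (by assumption) (by assumption) (by assumption) (by assumption)] at ha <;>
    first
      | (exfalso; omega)
      | simp only [arc, arcCore, List.map_cons, List.map_nil, s1, s2, s3,
          List.cons_append, List.nil_append]
  all_goals first
    | (refine ⟨.around, ?_⟩
       simp only [arc, arcCore, List.cons_append, List.nil_append]; done)
    | (refine ⟨.before, ?_⟩
       simp only [arc, arcCore, List.cons_append, List.nil_append]; done)
    | (refine ⟨.after, ?_⟩
       simp only [arc, arcCore, List.cons_append, List.nil_append]; done)

theorem exists_swap_arc_single_none {w : Perm ℕ} {o : Bool} {p : Side}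
    {lo hi u v : ℕ} (hf : lo + 2 < hi)
    (hw : IsPath w u (arc none o [p] lo hi) v) (huv : ArcEnds o lo hi u v) (hp : p ≠ .around) :
    ∃ i, (i = lo ∨ i + 1 = hi) ∧ ShiftAllowed w i (i + 1) ∧
      (arc none o [p] lo hi).map (swap i (i + 1)) = arc none o [.around] lo hi := by
  obtain ⟨h, rfl⟩ : ∃ h, hi = h + 2 := ⟨hi - 2, by omega⟩
  have eh : h + 2 - 1 = h + 1 := rfl
  have key : ∀ {P : ℕ → Prop},
      ((swap lo (lo + 1) lo = lo + 1 → swap lo (lo + 1) (lo + 1) = lo →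
        swap lo (lo + 1) (h + 1) = h + 1 → swap lo (lo + 1) (h + 2) = h + 2 →
          ShiftAllowed w lo (lo + 1) ∧ P lo) ∨
      (swap (h + 1) (h + 1 + 1) lo = lo → swap (h + 1) (h + 1 + 1) (lo + 1) = lo + 1 →
        swap (h + 1) (h + 1 + 1) (h + 1) = h + 2 → swap (h + 1) (h + 1 + 1) (h + 2) = h + 1 →
          ShiftAllowed w (h + 1) (h + 2) ∧ P (h + 1))) →
      ∃ i, (i = lo ∨ i + 1 = h + 2) ∧ ShiftAllowed w i (i + 1) ∧ P i := by
    rintro P (h1 | h1)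
    · exact ⟨lo, Or.inl rfl, h1 (swap_apply_left _ _) (swap_apply_right _ _)
        (swap_apply_of_ne_of_ne (by omega) (by omega))
        (swap_apply_of_ne_of_ne (by omega) (by omega))⟩
    · exact ⟨h + 1, Or.inr rfl, h1 (swap_apply_of_ne_of_ne (by omega) (by omega))
        (swap_apply_of_ne_of_ne (by omega) (by omega))
        (swap_apply_left _ _) (swap_apply_right _ _)⟩
  apply key
  clear key
  generalize swap lo (lo + 1) = g at *
  generalize swap (h + 1) (h + 1 + 1) = g' at *
  rcases p with _ | _ | _ <;> cases o <;> try exact absurd rfl hp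
  all_goals
    simp only [arc, arcCore, ArcEnds, List.cons_append, List.nil_append,
      isPath_cons, isPath_nil, eh] at hw huv
    casesm* _ ∧ _
    first
      | refine Or.inl fun s1 s2 s3 s4 => ⟨?_, ?_⟩
        · rw [shiftAllowed_iff (by assumption) (by assumption) (by assumption) (by assumption)]
          omega
        · simp only [arc, arcCore, List.map_cons, List.map_nil, eh, s1, s2, s3, s4,
            List.cons_append, List.nil_append]
      | refine Or.inr fun s1 s2 s3 s4 => ⟨?_, ?_⟩
        · rw [shiftAllowed_iff (by assumption) (by assumption) (by assumption) (by assumption)]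
          omega
        · simp only [arc, arcCore, List.map_cons, List.map_nil, eh, s1, s2, s3, s4,
            List.cons_append, List.nil_append]

/-- If the single entry of the core is at the right end of its range, it can be exchanged with the
pair around it. -/
theorem exists_swap_arc_single_some {o : Bool} {p : Side}
    {lo hi : ℕ} (hf : lo + 2 ≤ hi) (hp : p ≠ .around) :
    ∃ i m, (i = lo ∨ i + 1 = hi) ∧ (lo + 1 ≤ m ∧ m + 1 ≤ hi) ∧ ∀ {w : Perm ℕ} {u v : ℕ},
      IsPath w u (arc (some m) o [p] lo hi) v → ArcEnds o lo hi u v →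
      ShiftAllowed w i (i + 1) ∧
      (arc (some m) o [p] lo hi).map (swap i (i + 1)) = arc (some m) o [.around] lo hi := by
  obtain ⟨h, rfl⟩ : ∃ h, hi = h + 1 := ⟨hi - 1, by omega⟩
  have key : ∀ {P : ℕ → ℕ → Prop},
      ((swap lo (lo + 1) lo = lo + 1 → swap lo (lo + 1) (lo + 1) = lo →
        swap lo (lo + 1) (h + 1) = h + 1 → P lo (lo + 1)) ∨
      (swap h (h + 1) lo = lo → swap h (h + 1) h = h + 1 → swap h (h + 1) (h + 1) = h →
         P h h)) →
      ∃ i m, (i = lo ∨ i + 1 = h + 1) ∧ (lo + 1 ≤ m ∧ m + 1 ≤ h + 1) ∧ P i m := by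
    rintro P (h1 | h1)
    · exact ⟨lo, lo + 1, Or.inl rfl, ⟨le_rfl, by omega⟩, h1 (swap_apply_left _ _)
        (swap_apply_right _ _) (swap_apply_of_ne_of_ne (by omega) (by omega))⟩
    · exact ⟨h, h, Or.inr rfl, ⟨by omega, le_rfl⟩,
        h1 (swap_apply_of_ne_of_ne (by omega) (by omega))
        (swap_apply_left _ _) (swap_apply_right _ _)⟩
  apply key
  clear key
  generalize swap lo (lo + 1) = g at *
  generalize swap h (h + 1) = g' at *
  rcases p with _ | _ | _ <;> cases o <;> try exact absurd rfl hp
  all_goals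
    simp only [arc, arcCore, ArcEnds, List.cons_append, List.nil_append,
      isPath_cons, isPath_nil]
    first
      | refine Or.inl fun s1 s2 s3 {w u v} hw huv => ⟨?_, ?_⟩
        · casesm* _ ∧ _
          rw [shiftAllowed_iff (by assumption) (by assumption) (by assumption) (by assumption)]
          omega
        · simp only [List.map_cons, List.map_nil, s1, s2, s3]
      | refine Or.inr fun s1 s2 s3 {w u v} hw huv => ⟨?_, ?_⟩
        · casesm* _ ∧ _
          rw [shiftAllowed_iff (by assumption) (by assumption) (by assumption) (by assumption)]
          omega
        · simp only [List.map_cons, List.map_nil, s1, s2, s3]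

/-! ### Arcs are closed under shifts -/

/-- The orientation of the arc inside of a pair placed in the given way. -/
def Side.turn : Side → Bool → Bool
  | .before, o => o
  | .after, o => o
  | .around, true => false
  | .around, false => true

/-- The permutation `w` runs through an arc between `u` and `v`. If the core is a single entry, then
it fixes all other elements of `[lo, hi]`. -/
structure ArcState (c : Option ℕ) (o : Bool) (l : List Side) (lo hi u v : ℕ) (w : Perm ℕ) :
    Prop where
  fits : ArcFits c l.length lo hi
  path : IsPath w u (arc c o l lo hi) v
  ends : ArcEnds o lo hi u v
  fixed : c ≠ none → ∀ z, lo ≤ z → z ≤ hi → z ∉ arc c o l lo hi → w z = z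

/-- The outer pair supplies the missing ends of the inner arc; placing it around reverses the
direction from `u` to `v`, which is what `Side.turn` records. -/
theorem ArcState.tail {c : Option ℕ} {o : Bool} {p : Side} {l : List Side} {lo hi u v : ℕ}
    {w : Perm ℕ} (h : ArcState c o (p :: l) lo hi u v w) :
    ∃ u' v', ArcState c (p.turn o) l (lo + 1) (hi - 1) u' v' w := by
  have hf := h.fits.succ
  have hx : ∀ z, lo + 1 ≤ z → z ≤ hi - 1 → z ∉ arc c (p.turn o) l (lo + 1) (hi - 1) →
      z ∉ arc c o (p :: l) lo hi := by
    intro z h1 h2 h3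
    rcases p with _ | _ | _ <;> cases o <;> simp only [arc, Side.turn, List.mem_cons, List.mem_append, List.not_mem_nil] at h3 ⊢ <;>
      simp only [h3, not_or, or_false, false_or] <;> omega
  have hz : c ≠ none → ∀ z, lo + 1 ≤ z → z ≤ hi - 1 →
      z ∉ arc c (p.turn o) l (lo + 1) (hi - 1) → w z = z :=
    fun hc z h1 h2 h3 => h.fixed hc z (by omega) (by omega) (hx z h1 h2 h3)
  have hp := h.path
  have he := h.ends
  rcases p with _ | _ | _ <;> cases o <;>
    simp only [arc, isPath_cons, isPath_append_cons, isPath_nil, ArcEnds] at hp he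
  · exact ⟨_, _, hf.1, hp.2.2, by simp only [Side.turn, ArcEnds]; omega, hz⟩
  · exact ⟨_, _, hf.1, hp.2.2, by simp only [Side.turn, ArcEnds]; omega, hz⟩
  · exact ⟨_, _, hf.1, hp.1, by simp only [Side.turn, ArcEnds]; omega, hz⟩
  · exact ⟨_, _, hf.1, hp.1, by simp only [Side.turn, ArcEnds]; omega, hz⟩
  · exact ⟨_, _, hf.1, hp.2.1, by simp only [Side.turn, ArcEnds]; omega, hz⟩
  · exact ⟨_, _, hf.1, hp.2.1, by simp only [Side.turn, ArcEnds]; omega, hz⟩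

theorem map_arc_cons {c c' : Option ℕ} {o : Bool} {p : Side} {l l' : List Side} {lo hi : ℕ}
    {g : Perm ℕ} (h1 : g lo = lo) (h2 : g hi = hi)
    (h : (arc c (p.turn o) l (lo + 1) (hi - 1)).map g = arc c' (p.turn o) l' (lo + 1) (hi - 1)) :
    (arc c o (p :: l) lo hi).map g = arc c' o (p :: l') lo hi := by
  rcases p with _ | _ | _ <;> cases o <;> simp only [Side.turn] at h <;>
    simp [arc, h1, h2, h]

/-- A shift at the boundary of the range affects only the two outermost layers, which the local
moves cover; any other shift belongs to the inner arc, by induction. The first alternative is a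
shift inside the region enclosed by a two-entry core. -/
theorem ArcState.exists_map_swap {c : Option ℕ} {o : Bool} {l : List Side} {lo hi u v i : ℕ}
    {w : Perm ℕ} (h : ArcState c o l lo hi u v w)
    (hs : c = none → ∀ z, lo + l.length < z → z + l.length < hi →
      (lo + l.length < w z ∧ w z + l.length < hi) ∧
        lo + l.length < w⁻¹ z ∧ w⁻¹ z + l.length < hi)
    (h1 : lo ≤ i) (h2 : i + 1 ≤ hi) (ha : ShiftAllowed w i (i + 1)) :
    (c = none ∧ lo + l.length < i ∧ i + 1 + l.length < hi) ∨
      ∃ c' l', l'.length = l.length ∧ (c' = none ↔ c = none) ∧ ArcFits c' l.length lo hi ∧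
        (arc c o l lo hi).map (swap i (i + 1)) = arc c' o l' lo hi := by
  induction l generalizing o lo hi u v with
  | nil =>
    obtain _ | m := c
    · by_cases hi' : i = lo ∨ i + 1 = hi
      · exact absurd ha (not_shiftAllowed_arcCore_none (o := o) h.fits h.path h.ends
          (by simpa using hs) hi')
      · simp
        omega
    · obtain ⟨m', hm', e⟩ := exists_map_arcCore_some (o := o) h.fits
        (fun z h1 h2 h3 => h.fixed (by simp) z h1 h2 (by simpa [arc, arcCore] using h3)) h1 h2 ha
      exact Or.inr ⟨some m', [], rfl, by simp, hm', e⟩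
  | cons p l ih =>
    have hf := h.fits.succ
    by_cases hi' : i = lo ∨ i + 1 = hi
    · right
      cases l with
      | nil =>
        obtain _ | m := c
        · obtain ⟨p', e⟩ := exists_map_arc_single_none h.fits h.path h.ends hi' ha
          exact ⟨none, [p'], rfl, by simp, h.fits, e⟩
        · obtain ⟨p', e⟩ := exists_map_arc_single_some h.fits h.path h.ends
            (fun z h1 h2 h3 => h.fixed (by simp) z (by omega) (by omega) (by
              rw [mem_arc h.fits]
              simp [arcCore]
              omega)) hi' ha
          exact ⟨some m, [p'], rfl, by simp, h.fits, e⟩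
      | cons q l =>
        obtain ⟨p', q', e⟩ := exists_map_arc_pair h.fits h.path h.ends hi' ha
        exact ⟨c, p' :: q' :: l, rfl, Iff.rfl, h.fits, e⟩
    · obtain ⟨u', v', h'⟩ := h.tail
      simp only [List.length_cons] at hs ⊢
      rcases ih h' (fun hc z h1 h2 => by
        have := hs hc z (by omega) (by omega)
        omega) (by omega) (by omega) with ⟨h3, h4, h5⟩ | ⟨c', l', h3, h4, h5, e⟩
      · exact Or.inl ⟨h3, by omega, by omega⟩
      · refine Or.inr ⟨c', p :: l', by simp [h3], h4, ?_, map_arc_cons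
          (swap_apply_of_ne_of_ne (by omega) (by omega))
          (swap_apply_of_ne_of_ne (by omega) (by omega)) e⟩
        cases c' <;> simp only [ArcFits] at h5 ⊢ <;> omega

theorem ArcState.conj {c c' : Option ℕ} {o : Bool} {l l' : List Side} {lo hi u v : ℕ}
    {w g : Perm ℕ} (h : ArcState c o l lo hi u v w) (hf : ArcFits c' l'.length lo hi)
    (hc : c' = none ↔ c = none) (hg : ∀ z, z < lo ∨ hi < z → g z = z)
    (he : (arc c o l lo hi).map g = arc c' o l' lo hi) :
    ArcState c' o l' lo hi u v (g * w * g⁻¹) := by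
  refine ⟨hf, ?_, h.ends, ?_⟩
  · have hu : g u = u := hg u (by have := h.ends; cases o <;> simp only [ArcEnds] at this <;> omega)
    have hv : g v = v := hg v (by have := h.ends; cases o <;> simp only [ArcEnds] at this <;> omega)
    have := h.path.conj g
    rwa [hu, hv, he] at this
  · intro hc' z h1 h2 h3
    obtain ⟨t, rfl⟩ := g.surjective z
    have ht : lo ≤ t ∧ t ≤ hi := by
      by_contra hcon
      have := hg t (by omega)
      omega
    have := h.fixed (fun h => hc' (hc.2 h)) t ht.1 ht.2 fun hm =>
      h3 (he ▸ List.mem_map_of_mem hm)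
    simp [this]

/-! ### Arcs are connected by shifts -/

/-- Every permutation with the first arc can be shifted to one with the second arc. -/
def ArcConn (o : Bool) (lo hi : ℕ) (c : Option ℕ) (l : List Side) (c' : Option ℕ)
    (l' : List Side) : Prop :=
  ∀ w u v, ArcState c o l lo hi u v w → ∃ g : Perm ℕ,
    Relation.ReflTransGen (ShiftStep lo (hi + 1)) w (g * w * g⁻¹) ∧
    (arc c o l lo hi).map g = arc c' o l' lo hi ∧
    ∀ z, (z < lo ∨ hi < z ∨ (c = none ∧ lo + l.length < z ∧ z + l.length < hi)) → g z = z

theorem ArcConn.refl (o : Bool) (lo hi : ℕ) (c : Option ℕ) (l : List Side) :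
    ArcConn o lo hi c l c l :=
  fun _ _ _ _ => ⟨1, by simpa using Relation.ReflTransGen.refl, by simp, by simp⟩

theorem ArcConn.trans {o : Bool} {lo hi : ℕ} {c c' c'' : Option ℕ} {l l' l'' : List Side}
    (hl : l'.length = l.length) (hc : c' = none ↔ c = none) (hf : ArcFits c' l'.length lo hi)
    (h : ArcConn o lo hi c l c' l') (h' : ArcConn o lo hi c' l' c'' l'') :
    ArcConn o lo hi c l c'' l'' := by
  intro w u v hs
  obtain ⟨g, h1, h2, h3⟩ := h _ _ _ hs
  obtain ⟨g', h1', h2', h3'⟩ := h' _ _ _ (hs.conj hf hc (fun z hz => h3 z (by omega)) h2)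
  refine ⟨g' * g, ?_, ?_, ?_⟩
  · refine h1.trans ?_
    convert h1' using 1
    simp [mul_assoc]
  · rw [Perm.coe_mul, ← List.map_map, h2, h2']
  · intro z hz
    rw [Perm.mul_apply, h3 z hz, h3' z (by rw [hc, hl]; exact hz)]

theorem ArcConn.of_swap {o : Bool} {lo hi : ℕ} {c c' : Option ℕ} {l l' : List Side}
    (h : ∀ {w u v}, ArcState c o l lo hi u v w → ∃ i, lo ≤ i ∧ i + 1 ≤ hi ∧
      (c = none → ∀ z, lo + l.length < z ∧ z + l.length < hi → z ≠ i ∧ z ≠ i + 1) ∧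
      ShiftAllowed w i (i + 1) ∧
      (arc c o l lo hi).map (swap i (i + 1)) = arc c' o l' lo hi) :
    ArcConn o lo hi c l c' l' := by
  intro w u v hs
  obtain ⟨i, h1, h2, h3, h4, h5⟩ := h hs
  refine ⟨swap i (i + 1), .single ⟨i, h1, by omega, h4, by rw [swap_inv]⟩, h5, ?_⟩
  rintro z (hz | hz | ⟨hc, hz⟩)
  · exact swap_apply_of_ne_of_ne (by omega) (by omega)
  · exact swap_apply_of_ne_of_ne (by omega) (by omega)
  · exact swap_apply_of_ne_of_ne (h3 hc z hz).1 (h3 hc z hz).2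

theorem ArcConn.cons {o : Bool} {lo hi : ℕ} {c c' : Option ℕ} {l l' : List Side} (p : Side)
    (h : ArcConn (p.turn o) (lo + 1) (hi - 1) c l c' l') :
    ArcConn o lo hi c (p :: l) c' (p :: l') := by
  intro w u v hs
  obtain ⟨u', v', hs'⟩ := hs.tail
  have hle := hs.fits.succ
  obtain ⟨g, h1, h2, h3⟩ := h _ _ _ hs'
  refine ⟨g, ?_, map_arc_cons (h3 _ (by omega)) (h3 _ (by omega)) h2, ?_⟩
  · refine Relation.ReflTransGen.mono ?_ _ _ h1
    rintro _ _ ⟨i, h4, h5, h6⟩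
    exact ⟨i, by omega, by omega, h6⟩
  · intro z hz
    refine h3 z ?_
    rw [List.length_cons] at hz
    rcases hz with hz | hz | ⟨hc, hz⟩
    · omega
    · omega
    · exact Or.inr (Or.inr ⟨hc, by omega⟩)

theorem arcConn_around {o : Bool} {lo hi : ℕ} {c : Option ℕ} {l : List Side} {p : Side}
    (hp : p ≠ .around) : ArcConn o lo hi c (p :: .around :: l) c (.around :: p :: l) := by
  apply ArcConn.of_swap
  intro w u v h
  obtain ⟨i, h1, h2, h3⟩ := exists_swap_arc_around h.fits h.path h.ends hp
  have := h.fits.succ.2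
  refine ⟨i, by omega, by omega, ?_, h2, h3⟩
  intro _ z hz
  simp only [List.length_cons] at hz
  omega

theorem arcConn_single_none {o : Bool} {lo hi : ℕ} {p : Side} :
    ArcConn o lo hi none [p] none [.around] := by
  by_cases hp : p = .around
  · rw [hp]
    exact ArcConn.refl _ _ _ _ _
  apply ArcConn.of_swap
  intro w u v h
  obtain ⟨i, h1, h2, h3⟩ := exists_swap_arc_single_none h.fits h.path h.ends hp
  have := h.fits.succ.2
  refine ⟨i, by omega, by omega, ?_, h2, h3⟩
  intro _ z hz
  simp only [List.length_cons, List.length_nil] at hz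
  omega

theorem arcConn_core_succ {o : Bool} {lo hi m : ℕ} (h1 : lo ≤ m) (h2 : m + 1 ≤ hi) :
    ArcConn o lo hi (some m) [] (some (m + 1)) [] := by
  apply ArcConn.of_swap
  intro w u v h
  refine ⟨m, h1, h2, by simp, shiftAllowed_arcCore_some ⟨h1, h2⟩ h.path h.ends ?_,
    by simp [arc, arcCore]⟩
  exact h.fixed (by simp) _ (by omega) (by omega) (by simp [arc, arcCore])

theorem arcConn_core_pred {o : Bool} {lo hi m : ℕ} (h1 : lo ≤ m) (h2 : m + 1 ≤ hi) :
    ArcConn o lo hi (some (m + 1)) [] (some m) [] := by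
  apply ArcConn.of_swap
  intro w u v h
  refine ⟨m, h1, h2, by simp, shiftAllowed_arcCore_some' ⟨h1, h2⟩ h.path h.ends ?_,
    by simp [arc, arcCore]⟩
  exact h.fixed (by simp) _ (by omega) (by omega) (by simp [arc, arcCore])

theorem arcConn_core {o : Bool} {lo hi m m' : ℕ} (h : lo ≤ m ∧ m ≤ hi) (h' : lo ≤ m' ∧ m' ≤ hi) :
    ArcConn o lo hi (some m) [] (some m') [] := by
  have up : ∀ d, lo + d ≤ hi → ArcConn o lo hi (some lo) [] (some (lo + d)) [] := by
    intro d
    induction d with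
    | zero => exact fun _ => ArcConn.refl _ _ _ _ _
    | succ d ih =>
      intro hd
      exact ArcConn.trans rfl (by simp) (by simp only [ArcFits, List.length_nil]; omega) (ih (by omega))
        (arcConn_core_succ (by omega) (by omega))
  have down : ∀ d, lo + d ≤ hi → ArcConn o lo hi (some (lo + d)) [] (some lo) [] := by
    intro d
    induction d with
    | zero => exact fun _ => ArcConn.refl _ _ _ _ _
    | succ d ih =>
      intro hd
      exact ArcConn.trans (c' := some (lo + d)) (l' := []) rfl (by simp)
        (by simp only [ArcFits, List.length_nil]; omega)
        (arcConn_core_pred (m := lo + d) (by omega) (by omega)) (ih (by omega))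
  obtain ⟨d, rfl⟩ := Nat.exists_eq_add_of_le h.1
  obtain ⟨d', rfl⟩ := Nat.exists_eq_add_of_le h'.1
  exact ArcConn.trans rfl (by simp) (by simp only [ArcFits, List.length_nil]; omega) (down d h.2) (up d' h'.2)

theorem arcConn_single_some {o : Bool} {lo hi m m' : ℕ} {p : Side}
    (h : lo + 1 ≤ m ∧ m + 1 ≤ hi) (h' : lo + 1 ≤ m' ∧ m' + 1 ≤ hi) :
    ArcConn o lo hi (some m) [p] (some m') [.around] := by
  by_cases hp : p = .around
  · rw [hp]
    exact (arcConn_core (by omega) (by omega)).cons _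
  obtain ⟨i, m₀, h1, h2, h3⟩ := exists_swap_arc_single_some (o := o) (lo := lo) (hi := hi)
    (by omega) hp
  have hswap : ArcConn o lo hi (some m₀) [p] (some m₀) [.around] := by
    apply ArcConn.of_swap
    intro w u v h
    obtain ⟨h4, h5⟩ := h3 h.path h.ends
    exact ⟨i, by omega, by omega, by simp, h4, h5⟩
  exact ArcConn.trans (c' := some m₀) (l' := [p]) rfl (by simp) h2
    ((arcConn_core (m := m) (m' := m₀) (by omega) (by omega)).cons _)
    (ArcConn.trans (c' := some m₀) (l' := [.around]) rfl (by simp) h2 hswap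
      ((arcConn_core (by omega) (by omega)).cons _))

/-- By induction the tail becomes all `around`. If the head `p` is not `around`, it is exchanged
with the first `around` of the tail, and induction applies to the new tail, which starts with `p`.
-/
theorem arcConn_replicate {o : Bool} {lo hi : ℕ} {c c' : Option ℕ} {l : List Side}
    (hc : c' = none ↔ c = none) (hf : ArcFits c l.length lo hi) (hf' : ArcFits c' l.length lo hi) :
    ArcConn o lo hi c l c' (List.replicate l.length .around) := by
  induction hk : l.length generalizing o lo hi c l with
  | zero =>
    obtain rfl := List.length_eq_zero_iff.1 hk
    rcases c with _ | m <;> rcases c' with _ | m'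
    · exact ArcConn.refl _ _ _ _ _
    · simp at hc
    · simp at hc
    · exact arcConn_core hf hf'
  | succ k ih =>
    obtain ⟨p, l, rfl⟩ := List.exists_cons_of_length_eq_add_one hk
    have hk' : l.length = k := by simpa using hk
    rcases l with _ | ⟨q, l⟩
    · obtain rfl : k = 0 := hk'.symm
      rcases c with _ | m <;> rcases c' with _ | m'
      · exact arcConn_single_none
      · simp at hc
      · simp at hc
      · exact arcConn_single_some hf hf'
    · obtain ⟨j, rfl⟩ : ∃ j, k = j + 1 := ⟨l.length, hk'.symm⟩
      have h1 := (ih (o := p.turn o) hc hf.succ.1 hf'.succ.1 hk').cons p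
      by_cases hp : p = .around
      · rw [hp] at h1 ⊢
        exact h1
      · have hj : l.length = j := by simpa using hk'
        subst hj
        refine ArcConn.trans (by simp) hc (by simpa using hf') h1 ?_
        refine ArcConn.trans (by simp) Iff.rfl (by simpa using hf') (arcConn_around hp) ?_
        exact (ih (o := Side.turn .around o) (l := p :: List.replicate l.length .around) Iff.rfl
          (by simpa using hf'.succ.1) (by simpa using hf'.succ.1) (by simp)).cons .around

/-! ### Arcs closed up to cycles -/

/-- The permutation `w` maps every entry of the list to the next one, and the last to the first. -/
def IsCyclePath (w : Perm ℕ) : List ℕ → Prop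
  | [] => True
  | x :: l => IsPath w x l x

theorem IsCyclePath.conj {w : Perm ℕ} {l : List ℕ} (h : IsCyclePath w l) (g : Perm ℕ) :
    IsCyclePath (g * w * g⁻¹) (l.map g) := by
  cases l with
  | nil => trivial
  | cons x l => exact IsPath.conj h g

theorem IsCyclePath.apply_eq {w w' : Perm ℕ} {l : List ℕ} (h : IsCyclePath w l)
    (h' : IsCyclePath w' l) : ∀ z ∈ l, w z = w' z := by
  cases l with
  | nil => simp
  | cons x l => exact IsPath.apply_eq h h'

theorem isCyclePath_formPerm {l : List ℕ} (h : l.Nodup) : IsCyclePath l.formPerm l := by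
  cases l with
  | nil => trivial
  | cons x l => exact isPath_formPerm h

theorem IsCyclePath.congr {w w' : Perm ℕ} {l : List ℕ} (h : IsCyclePath w l)
    (hl : ∀ z ∈ l, w' z = w z) : IsCyclePath w' l := by
  cases l with
  | nil => trivial
  | cons x l => exact IsPath.congr h (hl x (by simp)) fun z hz => hl z (by simp [hz])

/-- The permutation `w` runs through an arc closed up by the outermost pair. If the core is a single
entry, then it fixes all other elements of `[lo, hi]`. -/
structure ArcCycle (c : Option ℕ) (o : Bool) (l : List Side) (lo hi : ℕ) (w : Perm ℕ) :
    Prop where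
  fits : ArcFits c (l.length + 1) lo hi
  path : IsCyclePath w (arc c o (.before :: l) lo hi)
  fixed : c ≠ none → ∀ z, lo ≤ z → z ≤ hi → z ∉ arc c o (.before :: l) lo hi → w z = z

theorem ArcCycle.state {c : Option ℕ} {o : Bool} {l : List Side} {lo hi : ℕ} {w : Perm ℕ}
    (h : ArcCycle c o l lo hi w) : ∃ u v, ArcState c o l (lo + 1) (hi - 1) u v w := by
  have hf := h.fits.succ
  have hp := h.path
  have hx : ∀ z, lo + 1 ≤ z → z ≤ hi - 1 → z ∉ arc c o l (lo + 1) (hi - 1) →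
      z ∉ arc c o (.before :: l) lo hi := by
    intro z h1 h2 h3
    cases o <;> simp only [arc, List.mem_cons, h3, or_false] <;> omega
  have hz : c ≠ none → ∀ z, lo + 1 ≤ z → z ≤ hi - 1 →
      z ∉ arc c o l (lo + 1) (hi - 1) → w z = z :=
    fun hc z h1 h2 h3 => h.fixed hc z (by omega) (by omega) (hx z h1 h2 h3)
  cases o
  · exact ⟨_, _, hf.1, hp.2, by simp only [ArcEnds]; omega, hz⟩
  · exact ⟨_, _, hf.1, hp.2, by simp only [ArcEnds]; omega, hz⟩

theorem ArcCycle.conj {c c' : Option ℕ} {o : Bool} {l l' : List Side} {lo hi : ℕ}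
    {w g : Perm ℕ} (h : ArcCycle c o l lo hi w) (hf : ArcFits c' l'.length (lo + 1) (hi - 1))
    (hc : c' = none ↔ c = none) (hg : ∀ z, z < lo + 1 ∨ hi - 1 < z → g z = z)
    (he : (arc c o l (lo + 1) (hi - 1)).map g = arc c' o l' (lo + 1) (hi - 1)) :
    ArcCycle c' o l' lo hi (g * w * g⁻¹) := by
  have hle := h.fits.succ.2
  have hlo := hg lo (by omega)
  have hhi := hg hi (by omega)
  have he' : (arc c o (.before :: l) lo hi).map g = arc c' o (.before :: l') lo hi :=
    map_arc_cons hlo hhi (p := .before) (by simpa only [Side.turn] using he)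
  refine ⟨?_, ?_, ?_⟩
  · cases c' <;> simp only [ArcFits] at hf ⊢ <;> omega
  · have := h.path.conj g
    rwa [he'] at this
  · intro hc' z h1 h2 h3
    obtain ⟨t, rfl⟩ := g.surjective z
    have ht : lo ≤ t ∧ t ≤ hi := by
      by_contra hcon
      have := hg t (by omega)
      omega
    have := h.fixed (fun h => hc' (hc.2 h)) t ht.1 ht.2 fun hm =>
      h3 (he' ▸ List.mem_map_of_mem hm)
    simp [this]

/-- When both exchanged points lie on the cycle, the new cycle has the same set of entries, so the
fixed points persist. -/
theorem ArcCycle.conj_swap_outer {c : Option ℕ} {o o' : Bool} {l l' : List Side} {lo hi i : ℕ}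
    {w : Perm ℕ} (h : ArcCycle c o l lo hi w) (hl : l'.length = l.length)
    (hi1 : i ∈ arc c o (.before :: l) lo hi) (hi2 : i + 1 ∈ arc c o (.before :: l) lo hi)
    (hp : IsCyclePath (swap i (i + 1) * w * swap i (i + 1)) (arc c o' (.before :: l') lo hi)) :
    ArcCycle c o' l' lo hi (swap i (i + 1) * w * swap i (i + 1)) := by
  have hf : ArcFits c (l'.length + 1) lo hi := hl ▸ h.fits
  refine ⟨hf, hp, fun hc z h1 h2 h3 => ?_⟩
  have h4 : z ∉ arc c o (.before :: l) lo hi := by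
    rw [mem_arc h.fits]
    rw [mem_arc hf] at h3
    simpa only [List.length_cons, hl] using h3
  have h5 : swap i (i + 1) z = z :=
    swap_apply_of_ne_of_ne (fun e => h4 (e ▸ hi1)) (fun e => h4 (e ▸ hi2))
  rw [Perm.mul_apply, Perm.mul_apply, h5, h.fixed hc z h1 h2 h4, h5]

/-- After a shift at the boundary, the cycle can be rotated to start with its outermost pair again,
but in the opposite order. This is the only kind of shift that changes the orientation. -/
theorem ArcCycle.exists_swap_outer_cons {c : Option ℕ} {o : Bool} {p : Side} {l : List Side}
    {lo hi i : ℕ} {w : Perm ℕ} (hcyc : ArcCycle c o (p :: l) lo hi w) (hi' : i = lo ∨ i + 1 = hi)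
    (ha : ShiftAllowed w i (i + 1)) : ∃ p', IsCyclePath (swap i (i + 1) * w * swap i (i + 1))
      (arc c (!o) (.before :: p' :: l) lo hi) := by
  have hf := hcyc.fits
  have hw := hcyc.path
  have hc := hcyc.path.conj (swap i (i + 1))
  rw [swap_inv] at hc
  clear hcyc
  have hh := hf.le
  rw [List.length_cons] at hh
  obtain ⟨h, rfl⟩ : ∃ h, hi = h + 2 := ⟨hi - 2, by omega⟩
  have hf2 := hf.succ.1.succ.1
  have eh : h + 2 - 1 = h + 1 := rfl
  have eh' : h + 1 - 1 = h := rfl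
  simp only [eh, eh'] at hf2
  have hm : ∀ o, (arc c o l (lo + 1 + 1) h).map (swap i (i + 1)) = arc c o l (lo + 1 + 1) h :=
    fun o => map_swap_arc hf2 (by omega) (by omega)
  have key : ∀ {P : Prop},
      (ShiftAllowed w lo (lo + 1) → swap i (i + 1) lo = lo + 1 → swap i (i + 1) (lo + 1) = lo →
        swap i (i + 1) (h + 1) = h + 1 → swap i (i + 1) (h + 2) = h + 2 → P) →
      (ShiftAllowed w (h + 1) (h + 2) → swap i (i + 1) lo = lo →
        swap i (i + 1) (lo + 1) = lo + 1 →
        swap i (i + 1) (h + 1) = h + 2 → swap i (i + 1) (h + 2) = h + 1 → P) → P := by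
    intro P h1 h2
    rcases hi' with rfl | hi'
    · exact h1 ha (swap_apply_left _ _) (swap_apply_right _ _)
        (swap_apply_of_ne_of_ne (by omega) (by omega))
        (swap_apply_of_ne_of_ne (by omega) (by omega))
    · obtain rfl : i = h + 1 := by omega
      exact h2 ha (swap_apply_of_ne_of_ne (by omega) (by omega))
        (swap_apply_of_ne_of_ne (by omega) (by omega))
        (swap_apply_left _ _) (swap_apply_right _ _)
  clear hi' ha
  generalize swap i (i + 1) = g at *
  generalize g * w * g = w' at *
  rcases p with _ | _ | _ <;> cases o <;>
    simp only [arc, List.cons_append, IsCyclePath, isPath_append_cons, isPath_cons, isPath_nil, eh, eh'] at hw <;>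
    casesm* _ ∧ _ <;>
    obtain ⟨a, b, ⟨_, _⟩, ⟨_, _⟩, _, _⟩ := IsPath.exists_arc_ends hf2 (by assumption) <;>
    refine key ?_ ?_ <;> intro ha s1 s2 s3 s4 <;>
    rw [shiftAllowed_iff (by assumption) (by assumption) (by assumption) (by assumption)] at ha <;>
    first
      | (exfalso; omega)
      | simp only [arc, List.map_cons, List.map_append, List.map_nil, eh, eh', s1, s2, s3, s4, hm,
          IsCyclePath, List.cons_append, isPath_append_cons, isPath_cons,
          isPath_nil] at hc
  all_goals first
    | (refine ⟨.around, ?_⟩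
       simp only [arc, Bool.not_true, Bool.not_false, eh, eh',
         IsCyclePath, isPath_append_cons, isPath_cons, isPath_nil, hc, and_self]; done)
    | (refine ⟨.before, ?_⟩
       simp only [arc, Bool.not_true, Bool.not_false, eh, eh',
         IsCyclePath, isPath_append_cons, isPath_cons, isPath_nil, hc, and_self]; done)
    | (refine ⟨.after, ?_⟩
       simp only [arc, Bool.not_true, Bool.not_false, eh, eh',
         IsCyclePath, isPath_append_cons, isPath_cons, isPath_nil, hc, and_self]; done)

theorem ArcCycle.exists_swap_outer {c : Option ℕ} {o : Bool} {l : List Side} {lo hi i : ℕ}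
    {w : Perm ℕ} (h : ArcCycle c o l lo hi w) (hi' : i = lo ∨ i + 1 = hi)
    (ha : ShiftAllowed w i (i + 1)) :
    i ∈ arc c o (.before :: l) lo hi ∧ i + 1 ∈ arc c o (.before :: l) lo hi ∧
    ∃ l', l'.length = l.length ∧
      ArcCycle c (!o) l' lo hi (swap i (i + 1) * w * swap i (i + 1)) := by
  have hle := h.fits.le
  cases l with
  | cons p l =>
    have h1 : i ∈ arc c o (.before :: p :: l) lo hi := by
      rw [mem_arc h.fits]
      simp only [List.length_cons] at hle ⊢
      omega
    have h2 : i + 1 ∈ arc c o (.before :: p :: l) lo hi := by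
      rw [mem_arc h.fits]
      simp only [List.length_cons] at hle ⊢
      omega
    obtain ⟨p', hp⟩ := h.exists_swap_outer_cons hi' ha
    exact ⟨h1, h2, p' :: l, rfl, h.conj_swap_outer (l' := p' :: l) rfl h1 h2 hp⟩
  | nil =>
    have key : i ∈ arc c o [.before] lo hi → i + 1 ∈ arc c o [.before] lo hi →
        IsCyclePath (swap i (i + 1) * w * swap i (i + 1)) (arc c (!o) [.before] lo hi) →
        i ∈ arc c o [.before] lo hi ∧ i + 1 ∈ arc c o [.before] lo hi ∧
        ∃ l', l'.length = 0 ∧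
          ArcCycle c (!o) l' lo hi (swap i (i + 1) * w * swap i (i + 1)) :=
      fun h1 h2 hp => ⟨h1, h2, [], rfl, h.conj_swap_outer (l' := []) rfl h1 h2 hp⟩
    have hw := h.path
    have hc := h.path.conj (swap i (i + 1))
    rw [swap_inv] at hc
    obtain _ | m := c
    · have hf : lo + 2 < hi := h.fits
      apply key
      · rw [mem_arc (l := [_]) h.fits]
        simp only [arcCore, List.length_cons, List.length_nil, List.mem_cons]
        omega
      · rw [mem_arc (l := [_]) h.fits]
        simp only [arcCore, List.length_cons, List.length_nil, List.mem_cons]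
        omega
      · obtain ⟨t, rfl⟩ : ∃ t, hi = t + 2 := ⟨hi - 2, by omega⟩
        have eh : t + 2 - 1 = t + 1 := rfl
        rcases hi' with rfl | hi'
        · have s3 : swap i (i + 1) (t + 1) = t + 1 :=
            swap_apply_of_ne_of_ne (by omega) (by omega)
          have s4 : swap i (i + 1) (t + 2) = t + 2 :=
            swap_apply_of_ne_of_ne (by omega) (by omega)
          cases o <;> simp only [arc, arcCore, List.map_cons, List.map_nil, swap_apply_left,
            swap_apply_right, s3, s4, eh, IsCyclePath, isPath_cons, isPath_nil, Bool.not_true,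
            Bool.not_false] at hc ⊢ <;> simp only [hc, and_self]
        · obtain rfl : i = t + 1 := by omega
          have e : t + 1 + 1 = t + 2 := rfl
          rw [e] at hc ⊢
          have s3 : swap (t + 1) (t + 2) lo = lo :=
            swap_apply_of_ne_of_ne (by omega) (by omega)
          have s4 : swap (t + 1) (t + 2) (lo + 1) = lo + 1 :=
            swap_apply_of_ne_of_ne (by omega) (by omega)
          cases o <;> simp only [arc, arcCore, List.map_cons, List.map_nil, swap_apply_left,
            swap_apply_right, s3, s4, eh, IsCyclePath, isPath_cons, isPath_nil, Bool.not_true,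
            Bool.not_false] at hc ⊢ <;> simp only [hc, and_self]
    · have hf : lo + 1 ≤ m ∧ m + 1 ≤ hi := h.fits
      have hfix : ∀ z, lo < z → z < hi → z ≠ m → w z = z := fun z h1 h2 h3 =>
        h.fixed (by simp) z h1.le h2.le (by
          rw [mem_arc (l := [_]) h.fits]
          simp only [arcCore, List.length_cons, List.length_nil, List.mem_cons, List.not_mem_nil,
            or_false]
          omega)
      -- Otherwise the neighbour of the outer entry is a fixed point, and the comparisons of images
      -- and preimages do not oppose each other.
      have him : (i = lo ∧ m = lo + 1) ∨ (i = m ∧ hi = m + 1) := by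
        rcases hi' with rfl | hi'
        · refine Or.inl ⟨rfl, ?_⟩
          by_contra hne
          have e := hfix (i + 1) (by omega) (by omega) (Ne.symm hne)
          cases o <;> simp only [arc, arcCore, IsCyclePath, isPath_cons, isPath_nil] at hw <;>
            casesm* _ ∧ _ <;>
            rw [shiftAllowed_iff (by assumption) (by assumption) (by assumption) (by assumption)]
              at ha <;> omega
        · subst hi'
          rcases eq_or_ne i m with rfl | hne
          · exact Or.inr ⟨rfl, rfl⟩
          exfalso
          have e := hfix i (by omega) (by omega) hne
          cases o <;> simp only [arc, arcCore, IsCyclePath, isPath_cons, isPath_nil] at hw <;>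
            casesm* _ ∧ _ <;>
            rw [shiftAllowed_iff (by assumption) (by assumption) (by assumption) (by assumption)]
              at ha <;> omega
      apply key
      · rw [mem_arc (l := [_]) h.fits]
        simp only [arcCore, List.length_cons, List.length_nil, List.mem_cons]
        omega
      · rw [mem_arc (l := [_]) h.fits]
        simp only [arcCore, List.length_cons, List.length_nil, List.mem_cons]
        omega
      · rcases him with ⟨rfl, rfl⟩ | ⟨rfl, rfl⟩
        · have s3 : swap i (i + 1) hi = hi := swap_apply_of_ne_of_ne (by omega) (by omega)
          cases o <;> simp only [arc, arcCore, List.map_cons, List.map_nil, swap_apply_left,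
            swap_apply_right, s3, IsCyclePath, isPath_cons, isPath_nil, Bool.not_true,
            Bool.not_false] at hc ⊢ <;> simp only [hc, and_self]
        · have s3 : swap i (i + 1) lo = lo := swap_apply_of_ne_of_ne (by omega) (by omega)
          cases o <;> simp only [arc, arcCore, List.map_cons, List.map_nil, swap_apply_left,
            swap_apply_right, s3, IsCyclePath, isPath_cons, isPath_nil, Bool.not_true,
            Bool.not_false] at hc ⊢ <;> simp only [hc, and_self]

theorem ArcCycle.shiftAllowed_around {c : Option ℕ} {o : Bool} {l : List Side} {lo hi : ℕ}
    {w : Perm ℕ} (h : ArcCycle c o (.around :: l) lo hi w) : ShiftAllowed w lo (lo + 1) := by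
  have hw := h.path
  have hh := h.fits.le
  rw [List.length_cons] at hh
  have hf2 := h.fits.succ.1.succ.1
  cases o <;>
    simp only [arc, List.cons_append, IsCyclePath, isPath_append_cons, isPath_cons, isPath_nil] at hw <;>
    casesm* _ ∧ _ <;>
    obtain ⟨a, b, ⟨_, _⟩, ⟨_, _⟩, _, _⟩ := IsPath.exists_arc_ends hf2 (by assumption) <;>
    rw [shiftAllowed_iff (by assumption) (by assumption) (by assumption) (by assumption)] <;>
    omega

theorem ArcCycle.shiftAllowed_nil {c : Option ℕ} {o : Bool} {lo hi : ℕ}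
    {w : Perm ℕ} (h : ArcCycle c o [] lo hi w) (hc : c = none ∨ c = some (lo + 1)) :
    ShiftAllowed w lo (lo + 1) := by
  have hw := h.path
  have hf := h.fits
  rcases hc with rfl | rfl <;> cases o <;>
    simp only [arc, arcCore, IsCyclePath, isPath_cons, isPath_nil, List.length_nil, ArcFits]
      at hw hf <;>
    casesm* _ ∧ _ <;>
    rw [shiftAllowed_iff (by assumption) (by assumption) (by assumption) (by assumption)] <;>
    omega

theorem ArcCycle.shift {c : Option ℕ} {o : Bool} {l : List Side} {lo hi i : ℕ}
    {w : Perm ℕ} (h : ArcCycle c o l lo hi w)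
    (hs : c = none → ∀ z, lo + (l.length + 1) < z → z + (l.length + 1) < hi →
      (lo + (l.length + 1) < w z ∧ w z + (l.length + 1) < hi) ∧
        lo + (l.length + 1) < w⁻¹ z ∧ w⁻¹ z + (l.length + 1) < hi)
    (h1 : lo ≤ i) (h2 : i + 1 ≤ hi) (ha : ShiftAllowed w i (i + 1)) :
    (c = none ∧ lo + (l.length + 1) < i ∧ i + 1 + (l.length + 1) < hi) ∨
      ((c = none → ∀ z, lo + (l.length + 1) < z → z + (l.length + 1) < hi → z ≠ i ∧ z ≠ i + 1) ∧
      ∃ c' o' l', l'.length = l.length ∧ (c' = none ↔ c = none) ∧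
        ArcCycle c' o' l' lo hi (swap i (i + 1) * w * swap i (i + 1))) := by
  have hle := h.fits.le
  have hnot : ∀ {z o' l'}, l'.length = l.length → c = none → lo + (l.length + 1) < z →
      z + (l.length + 1) < hi → z ∉ arc none o' (.before :: l') lo hi := by
    rintro z o' l' hl' rfl h1 h2 h3
    rw [mem_arc (by simpa only [List.length_cons, hl'] using h.fits)] at h3
    simp only [arcCore, List.length_cons, List.mem_cons, List.not_mem_nil, or_false, hl'] at h3
    omega
  by_cases hi' : i = lo ∨ i + 1 = hi
  · obtain ⟨h3, h4, l', h5, h6⟩ := h.exists_swap_outer hi' ha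
    refine Or.inr ⟨?_, c, !o, l', h5, Iff.rfl, h6⟩
    rintro rfl z hz1 hz2
    exact ⟨fun e => hnot rfl rfl hz1 hz2 (e ▸ h3), fun e => hnot rfl rfl hz1 hz2 (e ▸ h4)⟩
  · obtain ⟨u, v, h'⟩ := h.state
    rcases h'.exists_map_swap (fun hc z h1 h2 => by
      have := hs hc z (by omega) (by omega)
      omega) (by omega) (by omega) ha with ⟨h3, h4, h5⟩ | ⟨c', l', h3, h4, h5, e⟩
    · exact Or.inl ⟨h3, by omega, by omega⟩
    · by_cases hin : c = none ∧ lo + (l.length + 1) < i ∧ i + 1 + (l.length + 1) < hi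
      · exact Or.inl hin
      refine Or.inr ⟨?_, c', o, l', h3, h4, ?_⟩
      · rintro rfl z hz1 hz2
        replace hin : ¬ (lo + (l.length + 1) < i ∧ i + 1 + (l.length + 1) < hi) :=
          fun h => hin ⟨rfl, h⟩
        obtain rfl : c' = none := h4.2 rfl
        have hm := h'.fits
        have hm' := mem_arc (o := o) (l := l') (z := i) (by rw [h3]; exact hm)
        have hm'' := mem_arc (o := o) (l := l') (z := i + 1) (by rw [h3]; exact hm)
        -- The old and the new arc have the same entries, so the swap preserves this set. If one of
        -- `i`, `i + 1` were an inner point, the other would be one too, against `hin`.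
        have hmap : ∀ {t}, t ∈ arc none o l (lo + 1) (hi - 1) →
            swap i (i + 1) t ∈ arc none o l' (lo + 1) (hi - 1) :=
          fun ht => e ▸ List.mem_map_of_mem ht
        have h6 := hmap (t := i)
        have h7 := hmap (t := i + 1)
        rw [swap_apply_left, hm'', mem_arc hm] at h6
        rw [swap_apply_right, hm', mem_arc hm] at h7
        simp only [arcCore, List.mem_cons, List.not_mem_nil, or_false, h3] at h6 h7
        by_contra hcon
        omega
      · have := h.conj (g := swap i (i + 1)) (by rw [h3]; exact h5) h4
          (fun z hz => swap_apply_of_ne_of_ne (by omega) (by omega)) e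
        rwa [swap_inv] at this

theorem ArcCycle.conn {c c' : Option ℕ} {o : Bool} {l : List Side} {lo hi : ℕ}
    {w : Perm ℕ} (h : ArcCycle c o l lo hi w) (hc : c' = none ↔ c = none)
    (hf : ArcFits c' (l.length + 1) lo hi) :
    ∃ g : Perm ℕ, Relation.ReflTransGen (ShiftStep lo (hi + 1)) w (g * w * g⁻¹) ∧
      ArcCycle c' o (List.replicate l.length .around) lo hi (g * w * g⁻¹) ∧
      ∀ z, (z < lo ∨ hi < z ∨
        (c = none ∧ lo + (l.length + 1) < z ∧ z + (l.length + 1) < hi)) → g z = z := by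
  obtain ⟨u, v, h'⟩ := h.state
  have hle := h.fits.le
  obtain ⟨g, h1, h2, h3⟩ := arcConn_replicate hc h'.fits hf.succ.1 _ _ _ h'
  refine ⟨g, ?_, h.conj (by simpa using hf.succ.1) hc (fun z hz => h3 z (by omega)) h2, ?_⟩
  · refine Relation.ReflTransGen.mono ?_ _ _ h1
    rintro _ _ ⟨i, h4, h5, h6⟩
    exact ⟨i, by omega, by omega, h6⟩
  · intro z hz
    refine h3 z ?_
    rcases hz with hz | hz | ⟨hc, hz⟩
    · omega
    · omega
    · exact Or.inr (Or.inr ⟨hc, by omega⟩)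

theorem ArcCycle.exists_shift_replicate {c : Option ℕ} {o : Bool} {k lo hi : ℕ}
    {w : Perm ℕ} (h : ArcCycle c o (List.replicate k .around) lo hi w)
    (hc : c = none ∨ c = some (lo + 1 + k)) : ShiftAllowed w lo (lo + 1) := by
  cases k with
  | zero => exact ArcCycle.shiftAllowed_nil h hc
  | succ k => exact ArcCycle.shiftAllowed_around h

/-- If the orientation is wrong, the cycle is first brought to the form with all pairs around; there
a boundary shift is available, it reverses the orientation, and the placements are normalised once
more. -/
theorem ArcCycle.conn_true {c c' : Option ℕ} {o : Bool} {l : List Side} {lo hi : ℕ}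
    {w : Perm ℕ} (h : ArcCycle c o l lo hi w) (hc : c' = none ↔ c = none)
    (hf : ArcFits c' (l.length + 1) lo hi) :
    ∃ g : Perm ℕ, Relation.ReflTransGen (ShiftStep lo (hi + 1)) w (g * w * g⁻¹) ∧
      ArcCycle c' true (List.replicate l.length .around) lo hi (g * w * g⁻¹) ∧
      ∀ z, (z < lo ∨ hi < z ∨
        (c = none ∧ lo + (l.length + 1) < z ∧ z + (l.length + 1) < hi)) → g z = z := by
  cases o with
  | true => exact h.conn hc hf
  | false =>
    have hle := h.fits.le
    -- A single core entry is parked at the lower end of its range. If there are no free pairs, it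
    -- is then the neighbour of `lo`, as the boundary shift requires.
    obtain ⟨c₁, hc₁, hf₁, hc₁'⟩ : ∃ c₁ : Option ℕ, (c₁ = none ↔ c = none) ∧
        ArcFits c₁ (l.length + 1) lo hi ∧ (c₁ = none ∨ c₁ = some (lo + 1 + l.length)) := by
      have hf' := h.fits
      rcases c with _ | m
      · exact ⟨none, Iff.rfl, h.fits, Or.inl rfl⟩
      · refine ⟨some (lo + 1 + l.length), by simp, ?_, Or.inr rfl⟩
        simp only [ArcFits] at hf' ⊢
        omega
    obtain ⟨g, h1, h2, h3⟩ := h.conn hc₁ hf₁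
    have ha := h2.exists_shift_replicate hc₁'
    obtain ⟨h4, h4', l', h5, h6⟩ := h2.exists_swap_outer (Or.inl rfl) ha
    have h7 := h6.conn (c' := c') (by rw [hc, hc₁])
    rw [h5, List.length_replicate] at h7
    obtain ⟨g', h8, h9, h10⟩ := h7 hf
    have e : g' * swap lo (lo + 1) * g * w * (g' * swap lo (lo + 1) * g)⁻¹ =
        g' * (swap lo (lo + 1) * (g * w * g⁻¹) * swap lo (lo + 1)) * g'⁻¹ := by
      rw [mul_inv_rev, mul_inv_rev, swap_inv]
      simp only [mul_assoc]
    refine ⟨g' * swap lo (lo + 1) * g, ?_, e ▸ h9, ?_⟩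
    · exact h1.trans (.head ⟨lo, le_rfl, by omega, ha, rfl⟩ (e ▸ h8))
    · intro z hz
      have h11 : swap lo (lo + 1) z = z := by
        refine swap_apply_of_ne_of_ne ?_ ?_ <;> omega
      rw [Perm.mul_apply, Perm.mul_apply, h3 z hz, h11, h10 z (by rwa [hc₁])]

/-! ### The class as a product of outer cycles and inner permutations -/

/-- The permutation fixes everything outside of `[a, b)`. -/
def SupportedIn (a b : ℕ) (w : Perm ℕ) : Prop :=
  ∀ z, z < a ∨ b ≤ z → w z = z

theorem SupportedIn.inv {a b : ℕ} {w : Perm ℕ} (h : SupportedIn a b w) : SupportedIn a b w⁻¹ :=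
  fun z hz => by rw [Perm.inv_eq_iff_eq, h z hz]

theorem SupportedIn.mem {a b z : ℕ} {w : Perm ℕ} (h : SupportedIn a b w) (h1 : a ≤ z)
    (h2 : z < b) : a ≤ w z ∧ w z < b := by
  by_contra hcon
  have := w.injective (h (w z) (by omega))
  omega

theorem SupportedIn.of_mem_shiftClass {a b : ℕ} {v w : Perm ℕ} (h : SupportedIn a b v)
    (hw : w ∈ shiftClass a b v) : SupportedIn a b w := by
  induction (hw : Relation.ReflTransGen (ShiftStep a b) v w) with
  | refl => exact h
  | tail _ h2 ih =>
    obtain ⟨i, h3, h4, -, rfl⟩ := h2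
    intro z hz
    have hs : swap i (i + 1) z = z := swap_apply_of_ne_of_ne (by omega) (by omega)
    rw [Perm.mul_apply, Perm.mul_apply, hs, ih z hz, hs]

/-- A family of cycles on `[lo, a) ∪ [b, hi]` that is closed under shifts, and any two members of
which are connected by shifts, whatever the permutation of `[a, b)` is. -/
structure OuterCycles (lo hi a b : ℕ) {J : Type} (j₀ : J) (Cyc : J → Perm ℕ → Prop) : Prop where
  lo_le : lo ≤ a
  le_hi : b ≤ hi
  apply_eq : ∀ {j w w'}, Cyc j w → Cyc j w' → ∀ z, lo ≤ z → z ≤ hi → (z < a ∨ b ≤ z) → w z = w' z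
  congr : ∀ {j w w'}, Cyc j w → (∀ z, lo ≤ z → z ≤ hi → (z < a ∨ b ≤ z) → w' z = w z) → Cyc j w'
  exists_cycle : ∀ j, ∃ w, Cyc j w ∧ SupportedIn lo (hi + 1) w ∧ ∀ z, a ≤ z → z < b → w z = z
  inj : ∀ {j j' w}, Cyc j w → Cyc j' w → j = j'
  shift : ∀ {j w i}, Cyc j w → (∀ z, a ≤ z → z < b → (a ≤ w z ∧ w z < b) ∧ a ≤ w⁻¹ z ∧ w⁻¹ z < b) →
    lo ≤ i → i + 1 ≤ hi → ShiftAllowed w i (i + 1) → (a ≤ i ∧ i + 1 < b) ∨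
      ((∀ z, a ≤ z → z < b → z ≠ i ∧ z ≠ i + 1) ∧
        ∃ j', Cyc j' (swap i (i + 1) * w * swap i (i + 1)))
  conn : ∀ {j w}, Cyc j w → ∃ g : Perm ℕ,
    Relation.ReflTransGen (ShiftStep lo (hi + 1)) w (g * w * g⁻¹) ∧ Cyc j₀ (g * w * g⁻¹) ∧
      ∀ z, (z < lo ∨ hi < z ∨ (a ≤ z ∧ z < b)) → g z = z

section

variable {lo hi a b : ℕ} {J : Type} {j₀ : J} {Cyc : J → Perm ℕ → Prop}

/-- The permutation `w` is composed of the cycle `j` and of the permutation `τ` of `[a, b)`. -/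
structure OuterState (lo hi a b : ℕ) (Cyc : J → Perm ℕ → Prop) (j : J) (τ w : Perm ℕ) : Prop where
  cyc : Cyc j w
  inner : ∀ z, a ≤ z → z < b → w z = τ z
  outer : SupportedIn lo (hi + 1) w

theorem OuterState.inv_eq {j : J} {τ w : Perm ℕ} (h : OuterState lo hi a b Cyc j τ w)
    (hτ : SupportedIn a b τ) {z : ℕ} (h1 : a ≤ z) (h2 : z < b) : w⁻¹ z = τ⁻¹ z := by
  have h3 := hτ.inv.mem h1 h2
  rw [Perm.inv_eq_iff_eq, h.inner _ h3.1 h3.2]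
  simp

theorem OuterState.preserves {j : J} {τ w : Perm ℕ} (h : OuterState lo hi a b Cyc j τ w)
    (hτ : SupportedIn a b τ) (z : ℕ) (h1 : a ≤ z) (h2 : z < b) :
    (a ≤ w z ∧ w z < b) ∧ a ≤ w⁻¹ z ∧ w⁻¹ z < b := by
  rw [h.inv_eq hτ h1 h2, h.inner z h1 h2]
  exact ⟨hτ.mem h1 h2, hτ.inv.mem h1 h2⟩

theorem OuterState.apply_outer {j : J} {τ w : Perm ℕ} (h : OuterState lo hi a b Cyc j τ w)
    (hτ : SupportedIn a b τ) {z : ℕ} (hz : z < a ∨ b ≤ z) : w z < a ∨ b ≤ w z := by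
  by_contra hcon
  have := (h.preserves hτ (w z) (by omega) (by omega)).2
  rw [show w⁻¹ (w z) = z by simp] at this
  omega

theorem OuterCycles.state_unique (H : OuterCycles lo hi a b j₀ Cyc) {j : J} {τ w w' : Perm ℕ}
    (h : OuterState lo hi a b Cyc j τ w) (h' : OuterState lo hi a b Cyc j τ w') : w = w' := by
  ext z
  by_cases hz : z < lo ∨ hi + 1 ≤ z
  · rw [h.outer z hz, h'.outer z hz]
  · by_cases hz' : a ≤ z ∧ z < b
    · rw [h.inner z hz'.1 hz'.2, h'.inner z hz'.1 hz'.2]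
    · exact H.apply_eq h.cyc h'.cyc z (by omega) (by omega) (by omega)

theorem OuterCycles.exists_state (H : OuterCycles lo hi a b j₀ Cyc) (j : J) {τ : Perm ℕ}
    (hτ : SupportedIn a b τ) : ∃ w, OuterState lo hi a b Cyc j τ w := by
  obtain ⟨w, h1, h2, h3⟩ := H.exists_cycle j
  refine ⟨w * τ, H.congr h1 fun z _ _ hz => ?_, fun z hz1 hz2 => ?_, fun z hz => ?_⟩
  · rw [Perm.mul_apply, hτ z hz]
  · have := hτ.mem hz1 hz2
    rw [Perm.mul_apply, h3 _ this.1 this.2]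
  · have := H.lo_le
    have := H.le_hi
    rw [Perm.mul_apply, hτ z (by omega), h2 z hz]

theorem OuterCycles.state_inj (H : OuterCycles lo hi a b j₀ Cyc) {j j' : J} {τ τ' w : Perm ℕ}
    (hτ : SupportedIn a b τ) (hτ' : SupportedIn a b τ') (h : OuterState lo hi a b Cyc j τ w)
    (h' : OuterState lo hi a b Cyc j' τ' w) : j = j' ∧ τ = τ' := by
  refine ⟨H.inj h.cyc h'.cyc, ?_⟩
  ext z
  by_cases hz : a ≤ z ∧ z < b
  · rw [← h.inner z hz.1 hz.2, ← h'.inner z hz.1 hz.2]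
  · rw [hτ z (by omega), hτ' z (by omega)]

theorem OuterState.conj_swap {j : J} {τ w : Perm ℕ} (H : OuterCycles lo hi a b j₀ Cyc)
    (hτ : SupportedIn a b τ) (h : OuterState lo hi a b Cyc j τ w) {i : ℕ} (h1 : a ≤ i)
    (h2 : i + 1 < b) : OuterState lo hi a b Cyc j (swap i (i + 1) * τ * swap i (i + 1))
      (swap i (i + 1) * w * swap i (i + 1)) := by
  have := H.lo_le
  have := H.le_hi
  have hs : SupportedIn a b (swap i (i + 1)) :=
    fun z hz => swap_apply_of_ne_of_ne (by omega) (by omega)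
  refine ⟨H.congr h.cyc fun z _ _ hz => ?_, fun z hz1 hz2 => ?_, fun z hz => ?_⟩
  · rw [Perm.mul_apply, Perm.mul_apply, hs z hz, hs _ (h.apply_outer hτ hz)]
  · have := hs.mem hz1 hz2
    rw [Perm.mul_apply, Perm.mul_apply, h.inner _ this.1 this.2]
    rfl
  · rw [Perm.mul_apply, Perm.mul_apply, hs z (by omega), h.outer z hz, hs z (by omega)]

theorem OuterState.shift {j : J} {τ w w' : Perm ℕ} (H : OuterCycles lo hi a b j₀ Cyc)
    (hτ : SupportedIn a b τ) (h : OuterState lo hi a b Cyc j τ w)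
    (hw : ShiftStep lo (hi + 1) w w') : ∃ j', ∃ τ' ∈ shiftClass a b τ,
      OuterState lo hi a b Cyc j' τ' w' := by
  obtain ⟨i, h1, h2, ha, rfl⟩ := hw
  have hpres := h.preserves hτ
  rcases H.shift h.cyc hpres h1 (by omega) ha with ⟨h3, h4⟩ | ⟨h3, j', h4⟩
  · refine ⟨j, _, .single ⟨i, h3, h4, ?_, rfl⟩, h.conj_swap H hτ h3 h4⟩
    rwa [ShiftAllowed, ← h.inner i h3 (by omega), ← h.inner (i + 1) (by omega) h4,
      ← h.inv_eq hτ h3 (by omega), ← h.inv_eq hτ (by omega) h4]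
  · refine ⟨j', τ, .refl, h4, fun z hz1 hz2 => ?_, fun z hz => ?_⟩
    · have h5 := h3 z hz1 hz2
      have h6 := (hpres z hz1 hz2).1
      have h7 := h3 _ h6.1 h6.2
      rw [Perm.mul_apply, Perm.mul_apply, swap_apply_of_ne_of_ne h5.1 h5.2,
        swap_apply_of_ne_of_ne h7.1 h7.2, h.inner z hz1 hz2]
    · have hs : swap i (i + 1) z = z := swap_apply_of_ne_of_ne (by omega) (by omega)
      rw [Perm.mul_apply, Perm.mul_apply, hs, h.outer z hz, hs]

theorem OuterState.conn {j : J} {τ w : Perm ℕ} (H : OuterCycles lo hi a b j₀ Cyc)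
    (hτ : SupportedIn a b τ) (h : OuterState lo hi a b Cyc j τ w) :
    ∃ w', Relation.ReflTransGen (ShiftStep lo (hi + 1)) w w' ∧
      OuterState lo hi a b Cyc j₀ τ w' := by
  obtain ⟨g, h1, h2, h3⟩ := H.conn h.cyc
  have hg : ∀ z, (z < lo ∨ hi < z ∨ (a ≤ z ∧ z < b)) → g⁻¹ z = z :=
    fun z hz => by rw [Perm.inv_eq_iff_eq, h3 z hz]
  refine ⟨_, h1, h2, fun z hz1 hz2 => ?_, fun z hz => ?_⟩
  · have := (h.preserves hτ z hz1 hz2).1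
    rw [Perm.mul_apply, Perm.mul_apply, hg z (by omega), h3 _ (by omega), h.inner z hz1 hz2]
  · rw [Perm.mul_apply, Perm.mul_apply, hg z (by omega), h.outer z hz, h3 z (by omega)]

/-- Outer and inner shifts are independent: whether an inner shift is allowed depends on `τ` alone,
and outer shifts leave `τ` unchanged. Hence every pair of a cycle and a member of the class of `τ`
is reached. -/
theorem OuterCycles.mem_shiftClass_iff (H : OuterCycles lo hi a b j₀ Cyc) {j : J} {τ v w : Perm ℕ}
    (hτ : SupportedIn a b τ) (h : OuterState lo hi a b Cyc j τ v) :
    w ∈ shiftClass lo (hi + 1) v ↔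
      ∃ j', ∃ τ' ∈ shiftClass a b τ, OuterState lo hi a b Cyc j' τ' w := by
  have := H.lo_le
  have := H.le_hi
  constructor
  · intro hw
    induction (hw : Relation.ReflTransGen (ShiftStep lo (hi + 1)) v w) with
    | refl => exact ⟨j, τ, .refl, h⟩
    | tail _ h2 ih =>
      obtain ⟨j', τ', h3, h4⟩ := ih
      obtain ⟨j'', τ'', h5, h6⟩ := h4.shift H (hτ.of_mem_shiftClass h3) h2
      exact ⟨j'', τ'', Relation.ReflTransGen.trans h3 h5, h6⟩
  · rintro ⟨j', τ', h1, h2⟩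
    -- The route from `v` to `w`: normalise the cycle to `j₀`, carry out the inner shifts from `τ`
    -- to `τ'`, then reverse the normalisation of `w`.
    obtain ⟨v₀, h3, h4⟩ := h.conn H hτ
    have key : ∃ w₁, Relation.ReflTransGen (ShiftStep lo (hi + 1)) v₀ w₁ ∧
        OuterState lo hi a b Cyc j₀ τ' w₁ := by
      clear h2 w
      induction (h1 : Relation.ReflTransGen (ShiftStep a b) τ τ') with
      | refl => exact ⟨v₀, .refl, h4⟩
      | @tail σ _ hσ h6 ih =>
        obtain ⟨w₁, h7, h8⟩ := ih
        have hσ' := hτ.of_mem_shiftClass hσ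
        obtain ⟨i, h9, h10, h11, rfl⟩ := h6
        refine ⟨_, h7.tail ⟨i, by omega, by omega, ?_, rfl⟩, h8.conj_swap H hσ' h9 h10⟩
        rwa [ShiftAllowed, h8.inner i h9 (by omega), h8.inner (i + 1) (by omega) h10,
          h8.inv_eq hσ' h9 (by omega), h8.inv_eq hσ' (by omega) h10]
    obtain ⟨w₁, h5, h6⟩ := key
    obtain ⟨w₂, h7, h8⟩ := h2.conn H (hτ.of_mem_shiftClass h1)
    obtain rfl := H.state_unique h6 h8
    exact (h3.trans h5).trans (reflTransGen_shiftStep_symm h7)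

theorem OuterCycles.ncard_shiftClass (H : OuterCycles lo hi a b j₀ Cyc) {j : J} {τ v : Perm ℕ}
    (hτ : SupportedIn a b τ) (h : OuterState lo hi a b Cyc j τ v) :
    (shiftClass lo (hi + 1) v).ncard = Nat.card J * (shiftClass a b τ).ncard := by
  choose f hf using fun x : J × shiftClass a b τ =>
    H.exists_state x.1 (hτ.of_mem_shiftClass x.2.2)
  have hinj : Function.Injective f := by
    intro x y hxy
    have hx := hf x
    rw [hxy] at hx
    obtain ⟨h1, h2⟩ := H.state_inj (hτ.of_mem_shiftClass x.2.2) (hτ.of_mem_shiftClass y.2.2)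
      hx (hf y)
    exact Prod.ext h1 (Subtype.ext h2)
  have hrange : shiftClass lo (hi + 1) v = Set.range f := by
    ext w
    rw [H.mem_shiftClass_iff hτ h]
    constructor
    · rintro ⟨j', τ', h1, h2⟩
      exact ⟨(j', ⟨τ', h1⟩), H.state_unique (hf _) h2⟩
    · rintro ⟨x, rfl⟩
      exact ⟨x.1, x.2, x.2.2, hf x⟩
  rw [hrange, ← Nat.card_coe_set_eq, Nat.card_range_of_injective hinj, Nat.card_prod,
    Nat.card_coe_set_eq]

end

/-! ### The outer cycles of the even parts -/

theorem outerCycles_pair {lo hi : ℕ} (h : lo < hi) :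
    OuterCycles lo hi (lo + 1) hi () fun _ w => w lo = hi ∧ w hi = lo where
  lo_le := by omega
  le_hi := le_rfl
  apply_eq := by
    rintro - w w' ⟨h1, h2⟩ ⟨h3, h4⟩ z hz1 hz2 hz3
    obtain rfl | rfl : z = lo ∨ z = hi := by omega
    · rw [h1, h3]
    · rw [h2, h4]
  congr := by
    rintro - w w' ⟨h1, h2⟩ h3
    rw [h3 lo (by omega) (by omega) (by omega), h3 hi (by omega) (by omega) (by omega)]
    exact ⟨h1, h2⟩
  exists_cycle := by
    intro
    refine ⟨swap lo hi, by simp, fun z hz => ?_, fun z hz1 hz2 => ?_⟩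
    all_goals exact swap_apply_of_ne_of_ne (by omega) (by omega)
  inj := fun _ _ => rfl
  shift := by
    rintro - w i ⟨h1, h2⟩ h3 h4 h5 ha
    -- A 2-cycle of the extreme points is rigid: image and preimage of `lo` are both the maximum,
    -- those of `hi` both the minimum, so no shift at the boundary is allowed.
    left
    by_contra hcon
    obtain ⟨t, ht⟩ : ∃ t, w⁻¹ i = t := ⟨_, rfl⟩
    obtain ⟨t', ht'⟩ : ∃ t, w⁻¹ (i + 1) = t := ⟨_, rfl⟩
    have h6 := h3 i
    have h7 := h3 (i + 1)
    rw [ht] at h6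
    rw [ht'] at h7
    rw [Perm.inv_eq_iff_eq] at ht ht'
    rcases eq_or_ne i lo with rfl | hi1
    · rcases eq_or_ne (i + 1) hi with rfl | hi2
      · rw [shiftAllowed_iff h1 h2 h2 h1] at ha
        omega
      · rw [shiftAllowed_iff h1 rfl h2 ht'.symm] at ha
        omega
    · obtain rfl : i + 1 = hi := by omega
      rw [shiftAllowed_iff rfl h2 ht.symm h1] at ha
      omega
  conn := by
    rintro - w hw
    exact ⟨1, by simpa using Relation.ReflTransGen.refl, by simpa using hw, by simp⟩

/-- The image of `lo` is `hi` in one orientation and an entry strictly between them in the other. -/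
theorem ArcCycle.orientation_eq {c c' : Option ℕ} {o o' : Bool} {l l' : List Side} {lo hi : ℕ}
    {w : Perm ℕ} (h : ArcCycle c o l lo hi w) (h' : ArcCycle c' o' l' lo hi w) : o = o' := by
  have h1 := h.fits.succ
  have h1' := h'.fits.succ
  have hp := h.path
  have hp' := h'.path
  cases o <;> cases o' <;> simp only [arc, IsCyclePath, isPath_cons] at hp hp' <;> try rfl
  · obtain ⟨x, y, h2, h3, h4, h5⟩ := hp.2.exists_arc_ends h1.1
    rw [hp'.1] at h4
    omega
  · obtain ⟨x, y, h2, h3, h4, h5⟩ := hp.2.exists_arc_ends h1.1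
    rw [hp'.1] at h4
    omega

theorem ArcCycle.list_eq {c : Option ℕ} {o : Bool} {l l' : List Side} {lo hi : ℕ}
    {w : Perm ℕ} (h : ArcCycle c o l lo hi w) (h' : ArcCycle c o l' lo hi w)
    (hl : l.length = l'.length) : l = l' := by
  have hp := h.path
  have hp' := h'.path
  cases o <;> simp only [arc, IsCyclePath, isPath_cons] at hp hp'
  all_goals
    exact arc_injective h.fits.succ.1 hl
      (hp.2.eq_of_length_eq hp'.2 (by rw [length_arc, length_arc, hl]))

theorem mem_arc_none {o : Bool} {l : List Side} {lo hi z : ℕ} (h : ArcFits none l.length lo hi) :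
    z ∈ arc none o l lo hi ↔ lo ≤ z ∧ z ≤ hi ∧ (z < lo + l.length + 1 ∨ hi - l.length ≤ z) := by
  rw [mem_arc h]
  simp only [ArcFits] at h
  simp only [arcCore, List.mem_cons, List.not_mem_nil, or_false]
  omega

theorem outerCycles_arc {K lo hi : ℕ} (h : lo + 2 * (K + 1) < hi) :
    OuterCycles lo hi (lo + (K + 1) + 1) (hi - (K + 1))
      (true, (⟨List.replicate K .around, by simp⟩ : List.Vector Side K))
      fun j w => ArcCycle none j.1 j.2.1 lo hi w where
  lo_le := by omega
  le_hi := by omega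
  apply_eq := by
    rintro ⟨o, l, hl⟩ w w' h1 h2 z hz1 hz2 hz3
    refine h1.path.apply_eq h2.path z ?_
    have hf : ArcFits none (Side.before :: l).length lo hi := h1.fits
    rw [mem_arc_none hf, List.length_cons, hl]
    omega
  congr := by
    rintro ⟨o, l, hl⟩ w w' h1 h2
    refine ⟨h1.fits, h1.path.congr fun z hz => ?_, fun h => absurd rfl h⟩
    have hf : ArcFits none (Side.before :: l).length lo hi := h1.fits
    rw [mem_arc_none hf, List.length_cons, hl] at hz
    exact h2 z hz.1 hz.2.1 hz.2.2
  exists_cycle := by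
    rintro ⟨o, l, hl⟩
    have hf : ArcFits none (Side.before :: l).length lo hi := by
      rw [List.length_cons, hl]
      exact h
    have hm : ∀ z, z < lo ∨ hi < z ∨ (lo + (K + 1) + 1 ≤ z ∧ z < hi - (K + 1)) →
        (arc none o (.before :: l) lo hi).formPerm z = z := by
      intro z hz
      apply List.formPerm_apply_of_notMem
      rw [mem_arc_none hf, List.length_cons, hl]
      omega
    refine ⟨_, ⟨hf, isCyclePath_formPerm (nodup_arc hf), fun h => absurd rfl h⟩, ?_, ?_⟩
    · exact fun z hz => hm z (by omega)
    · exact fun z hz1 hz2 => hm z (by omega)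
  inj := by
    rintro ⟨o, l, hl⟩ ⟨o', l', hl'⟩ w h1 h2
    obtain rfl := h1.orientation_eq h2
    obtain rfl := h1.list_eq h2 (hl.trans hl'.symm)
    rfl
  shift := by
    rintro ⟨o, l, hl⟩ w i h1 h2 h3 h4 ha
    rcases h1.shift (fun _ z hz1 hz2 => by
      simp only [hl] at hz1 hz2 ⊢
      have := h2 z (by omega) (by omega)
      omega) h3 h4 ha with ⟨-, h5, h6⟩ | ⟨h5, c', o', l', h6, h7, h8⟩
    · simp only [hl] at h5 h6
      exact Or.inl ⟨by omega, by omega⟩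
    · obtain rfl := h7.2 rfl
      refine Or.inr ⟨fun z hz1 hz2 => h5 rfl z ?_ ?_, (o', ⟨l', h6.trans hl⟩), h8⟩
      all_goals
        simp only [hl]
        omega
  conn := by
    rintro ⟨o, l, hl⟩ w h1
    obtain ⟨g, h2, h3, h4⟩ := h1.conn_true Iff.rfl h1.fits
    simp only [hl] at h3 h4
    refine ⟨g, h2, h3, fun z hz => h4 z ?_⟩
    rcases hz with hz | hz | hz
    · exact Or.inl hz
    · exact Or.inr (Or.inl hz)
    · exact Or.inr (Or.inr ⟨trivial, by omega, by omega⟩)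

/-! ### Stair forms in terms of arcs, and the resulting counts -/

/-- An even initial piece removes equally many points at both ends, so what remains is again a stair
list. This is why even parts can be split off from the front. -/
theorem drop_stairs (a k m : ℕ) : (stairs a (2 * k + m)).drop (2 * k) = stairs (a + k) m := by
  induction k generalizing a with
  | zero => simp
  | succ k ih =>
    have e : 2 * (k + 1) + m = 2 * k + m + 2 := by omega
    rw [e, stairs, show 2 * (k + 1) = 2 * k + 1 + 1 by omega, List.drop_succ_cons,
      List.drop_succ_cons, ih, Nat.add_right_comm, Nat.add_assoc]

theorem take_stairs_even (a k m : ℕ) : (stairs a (2 * (k + 1) + m)).take (2 * (k + 1)) =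
    arc none true (List.replicate k .before) a (a + 2 * k + 1 + m) := by
  induction k generalizing a with
  | zero =>
    rw [show 2 * (0 + 1) + m = m + 2 by omega, stairs]
    simp [arc, arcCore]
    omega
  | succ k ih =>
    have e : 2 * (k + 1 + 1) + m = 2 * (k + 1) + m + 2 := by omega
    rw [e, stairs, show 2 * (k + 1 + 1) = 2 * (k + 1) + 1 + 1 by omega, List.take_succ_cons,
      List.take_succ_cons, ih, List.replicate_succ, arc]
    congr 2
    · omega
    · congr 1
      omega

theorem take_stairs_odd (a k m : ℕ) : (stairs a (2 * k + 1 + m)).take (2 * k + 1) =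
    arc (some (a + k)) true (List.replicate k .before) a (a + 2 * k + m) := by
  induction k generalizing a with
  | zero =>
    cases m with
    | zero => simp [stairs, arc, arcCore]
    | succ m =>
      rw [show 2 * 0 + 1 + (m + 1) = m + 2 by omega, stairs]
      simp [arc, arcCore]
  | succ k ih =>
    have e : 2 * (k + 1) + 1 + m = 2 * k + 1 + m + 2 := by omega
    rw [e, stairs, show 2 * (k + 1) + 1 = 2 * k + 1 + 1 + 1 by omega, List.take_succ_cons,
      List.take_succ_cons, ih, List.replicate_succ, arc]
    congr 2
    · omega
    · rw [show a + 1 + k = a + (k + 1) by omega]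
      congr 1
      omega

theorem stairPerm_cons_even (a k : ℕ) (l : List ℕ) : stairPerm a (2 * (k + 1) :: l) =
    (arc none true (List.replicate k .before) a (a + 2 * k + 1 + l.sum)).formPerm *
      stairPerm (a + (k + 1)) l := by
  rw [stairPerm, List.sum_cons, List.splitLengths_cons, List.map_cons, List.prod_cons,
    take_stairs_even, drop_stairs, stairPerm]

theorem prod_formPerm_splitLengths_replicate (c : ℕ) (s : List ℕ) :
    (((List.replicate c 1).splitLengths s).map List.formPerm).prod = 1 := by
  induction c generalizing s with
  | zero => simp
  | succ c ih =>
    rw [List.replicate_succ, List.splitLengths_cons, List.map_cons, List.prod_cons, ih, mul_one]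
    cases s <;> simp

theorem stairPerm_replicate_one (a c : ℕ) : stairPerm a (List.replicate c 1) = 1 :=
  prod_formPerm_splitLengths_replicate _ _

theorem stairPerm_cons_odd (a k c : ℕ) : stairPerm a ((2 * k + 1) :: List.replicate c 1) =
    (arc (some (a + k)) true (List.replicate k .before) a (a + 2 * k + c)).formPerm := by
  rw [stairPerm, List.sum_cons, List.splitLengths_cons, List.map_cons, List.prod_cons,
    prod_formPerm_splitLengths_replicate, mul_one, take_stairs_odd]
  simp

theorem shiftClass_one (a b : ℕ) : shiftClass a b 1 = {1} := by
  ext w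
  constructor
  · intro h
    induction (h : Relation.ReflTransGen (ShiftStep a b) 1 w) with
    | refl => rfl
    | tail _ h2 ih =>
      obtain ⟨i, -, -, h3, -⟩ := h2
      rw [ih, shiftAllowed_iff (Perm.one_apply i) (Perm.one_apply (i + 1)) (Perm.one_apply i)
        (Perm.one_apply (i + 1))] at h3
      omega
  · rintro rfl
    exact Relation.ReflTransGen.refl

theorem stairCount_replicate_one (c : ℕ) : stairCount (List.replicate c 1) = 1 := by
  rw [stairCount, stairPerm_replicate_one, shiftClass_one, Set.ncard_singleton]

theorem card_side_vector (K : ℕ) : Nat.card (Bool × List.Vector Side K) = 2 * 3 ^ K := by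
  rw [Nat.card_prod, Nat.card_eq_fintype_card, Nat.card_eq_fintype_card, card_vector,
    Fintype.card_bool]
  rfl

theorem supportedIn_stairPerm {l : List ℕ} (hl : ∀ k ∈ l, 0 < k) (a : ℕ) :
    SupportedIn a (a + l.sum) (stairPerm a l) :=
  fun _ hz => stairPerm_mem_Ico hl hz

theorem stairCount_two_cons {l : List ℕ} (hl : ∀ k ∈ l, 0 < k) :
    stairCount (2 :: l) = stairCount l := by
  have H := outerCycles_pair (lo := 0) (hi := 1 + l.sum) (by omega)
  have hτ := supportedIn_stairPerm hl 1
  have e : stairPerm 0 (2 :: l) = swap 0 (1 + l.sum) * stairPerm 1 l := by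
    simpa [arc, arcCore] using stairPerm_cons_even 0 0 l
  have hs : ∀ z, z ≠ 0 → z ≠ 1 + l.sum → swap 0 (1 + l.sum) z = z :=
    fun z h1 h2 => swap_apply_of_ne_of_ne h1 h2
  have hst : OuterState 0 (1 + l.sum) (0 + 1) (1 + l.sum)
      (fun (_ : Unit) (w : Perm ℕ) => w 0 = 1 + l.sum ∧ w (1 + l.sum) = 0) () (stairPerm 1 l)
      (stairPerm 0 (2 :: l)) := by
    rw [e]
    refine ⟨⟨?_, ?_⟩, fun z h1 h2 => ?_, fun z hz => ?_⟩
    · rw [Perm.mul_apply, hτ 0 (by omega), swap_apply_left]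
    · rw [Perm.mul_apply, hτ _ (by omega), swap_apply_right]
    · have := hτ.mem (z := z) (by omega) h2
      rw [Perm.mul_apply, hs _ (by omega) (by omega)]
    · rw [Perm.mul_apply, hτ _ (by omega), hs _ (by omega) (by omega)]
  have := H.ncard_shiftClass hτ hst
  rw [stairCount, ← ncard_shiftClass_stairPerm hl 1, List.sum_cons,
    show 2 + l.sum = 1 + l.sum + 1 by omega, this]
  simp

theorem stairCount_even_cons {l : List ℕ} (hl : ∀ k ∈ l, 0 < k) (K : ℕ) :
    stairCount (2 * (K + 2) :: l) = 2 * 3 ^ K * stairCount l := by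
  -- The largest point: the parts add up to `hi + 1`, since the interval starts at 0.
  obtain ⟨hi, hhi⟩ : ∃ hi, hi = 0 + 2 * (K + 1) + 1 + l.sum := ⟨_, rfl⟩
  have H := outerCycles_arc (K := K) (lo := 0) (hi := hi) (by omega)
  have hτ := supportedIn_stairPerm hl (K + 2)
  rw [show K + 2 + l.sum = hi - (K + 1) by omega, show K + 2 = 0 + (K + 1) + 1 by omega] at hτ
  have e := stairPerm_cons_even 0 (K + 1) l
  rw [← hhi, show 0 + (K + 1 + 1) = 0 + (K + 1) + 1 by omega] at e
  have hf : ArcFits none (Side.before :: List.replicate K Side.before).length 0 hi := by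
    simp only [ArcFits, List.length_cons, List.length_replicate]
    omega
  have hm : ∀ z, z ∈ arc none true (.before :: List.replicate K .before) 0 hi ↔
      z ≤ hi ∧ (z < 0 + (K + 1) + 1 ∨ hi - (K + 1) ≤ z) := by
    intro z
    rw [mem_arc_none hf, List.length_cons, List.length_replicate]
    simp
  have hst : OuterState 0 hi (0 + (K + 1) + 1) (hi - (K + 1))
      (fun (j : Bool × List.Vector Side K) w => ArcCycle none j.1 j.2.1 0 hi w)
      (true, ⟨List.replicate K .before, by simp⟩) (stairPerm (0 + (K + 1) + 1) l)
      (stairPerm 0 (2 * (K + 1 + 1) :: l)) := by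
    rw [e]
    refine ⟨⟨hf, ?_, fun h => absurd rfl h⟩, fun z h1 h2 => ?_, fun z hz => ?_⟩
    · refine (isCyclePath_formPerm (nodup_arc hf)).congr fun z hz => ?_
      rw [hm] at hz
      rw [Perm.mul_apply, hτ z hz.2]
      rfl
    · have := hτ.mem h1 h2
      rw [Perm.mul_apply]
      apply List.formPerm_apply_of_notMem
      rw [List.replicate_succ, hm]
      omega
    · rw [Perm.mul_apply, hτ z (by omega)]
      apply List.formPerm_apply_of_notMem
      rw [List.replicate_succ, hm]
      omega
  have := H.ncard_shiftClass hτ hst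
  have hc : Nat.card (Bool × {l : List Side // l.length = K}) = 2 * 3 ^ K := card_side_vector K
  rw [hc, show hi - (K + 1) = 0 + (K + 1) + 1 + l.sum by omega,
    ncard_shiftClass_stairPerm hl] at this
  rw [← this, stairCount, List.sum_cons, show 2 * (K + 2) + l.sum = hi + 1 by omega]

/-- All entries of the cycle except the core are determined by the number of pairs. If the cores
differed, `m` would be moved according to one description and fixed according to the other. -/
theorem ArcCycle.core_eq {m m' : ℕ} {o o' : Bool} {l l' : List Side} {lo hi : ℕ}
    {w : Perm ℕ} (h : ArcCycle (some m) o l lo hi w) (h' : ArcCycle (some m') o' l' lo hi w)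
    (hl : l.length = l'.length) : m = m' := by
  by_contra hne
  have hf : ArcFits (some m) (Side.before :: l).length lo hi := h.fits
  have hf' := h'.fits
  rw [← hl] at hf'
  simp only [ArcFits, List.length_cons] at hf hf'
  have h1 : m ∈ arc (some m) o (.before :: l) lo hi := by
    rw [mem_arc h.fits]
    simp [arcCore]
  have h2 : m ∉ arc (some m') o' (.before :: l') lo hi := by
    rw [mem_arc h'.fits]
    simp only [arcCore, List.length_cons, List.mem_cons, List.not_mem_nil, or_false, ← hl]
    omega
  have h3 := h'.fixed (by simp) m (by omega) (by omega) h2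
  rw [h.path.apply_eq (isCyclePath_formPerm (nodup_arc h.fits)) m h1,
    List.formPerm_apply_mem_eq_self_iff _ (nodup_arc h.fits) m h1, length_arc] at h3
  simp [arcCore] at h3

theorem ArcCycle.unique {m lo hi : ℕ} {o : Bool} {l : List Side} {w w' : Perm ℕ}
    (h : ArcCycle (some m) o l lo hi w) (h' : ArcCycle (some m) o l lo hi w')
    (hw : SupportedIn lo (hi + 1) w) (hw' : SupportedIn lo (hi + 1) w') : w = w' := by
  ext z
  by_cases hz : z < lo ∨ hi + 1 ≤ z
  · rw [hw z hz, hw' z hz]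
  · by_cases hz' : z ∈ arc (some m) o (.before :: l) lo hi
    · exact h.path.apply_eq h'.path z hz'
    · rw [h.fixed (by simp) z (by omega) (by omega) hz',
        h'.fixed (by simp) z (by omega) (by omega) hz']

theorem arcCycle_formPerm {m lo hi : ℕ} {o : Bool} {l : List Side}
    (hf : ArcFits (some m) (l.length + 1) lo hi) :
    ArcCycle (some m) o l lo hi (arc (some m) o (.before :: l) lo hi).formPerm ∧
      SupportedIn lo (hi + 1) (arc (some m) o (.before :: l) lo hi).formPerm := by
  refine ⟨⟨hf, isCyclePath_formPerm (nodup_arc hf),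
    fun _ z _ _ hz => List.formPerm_apply_of_notMem hz⟩, fun z hz => ?_⟩
  refine List.formPerm_apply_of_notMem fun hz' => ?_
  have := le_of_mem_arc hf hz'
  omega

theorem mem_shiftClass_arcCycle_iff {m lo hi : ℕ} {o : Bool} {l : List Side} {v w : Perm ℕ}
    (h : ArcCycle (some m) o l lo hi v) (hv : SupportedIn lo (hi + 1) v) :
    w ∈ shiftClass lo (hi + 1) v ↔ ∃ m' o' l', l'.length = l.length ∧
      ArcCycle (some m') o' l' lo hi w ∧ SupportedIn lo (hi + 1) w := by
  constructor
  · intro hw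
    have hsup := hv.of_mem_shiftClass hw
    suffices hs : ∃ m' o' l', l'.length = l.length ∧ ArcCycle (some m') o' l' lo hi w by
      obtain ⟨m', o', l', h1, h2⟩ := hs
      exact ⟨m', o', l', h1, h2, hsup⟩
    clear hsup
    induction (hw : Relation.ReflTransGen (ShiftStep lo (hi + 1)) v w) with
    | refl => exact ⟨m, o, l, rfl, h⟩
    | tail h1 h2 ih =>
      obtain ⟨m', o', l', h3, h4⟩ := ih
      obtain ⟨i, h5, h6, h7, rfl⟩ := h2
      rcases h4.shift (by simp) h5 (by omega) h7 with ⟨h8, -⟩ | ⟨-, c, o'', l'', h8, h9, h10⟩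
      · simp at h8
      · rcases c with _ | m''
        · simp at h9
        · exact ⟨m'', o'', l'', h8.trans h3, h10⟩
  · rintro ⟨m', o', l', h1, h2, h3⟩
    have hf := h.fits
    obtain ⟨g, h4, h5, -⟩ := h.conn_true (c' := some m) Iff.rfl hf
    obtain ⟨g', h6, h7, -⟩ := h2.conn_true (c' := some m) (by simp) (by rwa [h1])
    rw [h1] at h7
    have e := h5.unique h7 (hv.of_mem_shiftClass h4) (h3.of_mem_shiftClass h6)
    rw [e] at h4
    exact Relation.ReflTransGen.trans h4 (reflTransGen_shiftStep_symm h6)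

/-- The class consists of all cycles with `K` free pairs and a single core. The core ranges over the
`c + 1` points from `K + 1` to `K + 1 + c`, and each position admits `2 * 3 ^ K` shapes. -/
theorem stairCount_hook (K c : ℕ) :
    stairCount ((2 * (K + 1) + 1) :: List.replicate c 1) = (c + 1) * (2 * 3 ^ K) := by
  obtain ⟨hi, hhi⟩ : ∃ hi, hi = 0 + 2 * (K + 1) + c := ⟨_, rfl⟩
  have e := stairPerm_cons_odd 0 (K + 1) c
  rw [← hhi, List.replicate_succ] at e
  have hfits : ∀ {l : List Side} (x : Fin (c + 1)), l.length = K →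
      ArcFits (some (K + 1 + x)) (l.length + 1) 0 hi := by
    intro l x hl
    have := x.2
    simp only [ArcFits, hl]
    omega
  have hcyc := arcCycle_formPerm (m := 0 + (K + 1)) (lo := 0) (hi := hi) (o := true)
    (l := List.replicate K .before) (by
      simp only [ArcFits, List.length_replicate]
      omega)
  let f : Fin (c + 1) × (Bool × List.Vector Side K) → Perm ℕ := fun x =>
    (arc (some (K + 1 + x.1)) x.2.1 (.before :: x.2.2.1) 0 hi).formPerm
  have hf : ∀ x, ArcCycle (some (K + 1 + x.1)) x.2.1 x.2.2.1 0 hi (f x) ∧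
      SupportedIn 0 (hi + 1) (f x) := fun x => arcCycle_formPerm (hfits x.1 x.2.2.2)
  have hinj : Function.Injective f := by
    rintro ⟨x, o, l, hl⟩ ⟨x', o', l', hl'⟩ hxx
    have h1 := (hf ⟨x, o, l, hl⟩).1
    have h2 := (hf ⟨x', o', l', hl'⟩).1
    rw [hxx] at h1
    have hx := h1.core_eq h2 (hl.trans hl'.symm)
    obtain rfl : x = x' := Fin.ext (by simpa using hx)
    obtain rfl := h1.orientation_eq h2
    obtain rfl := h1.list_eq h2 (hl.trans hl'.symm)
    rfl
  have hrange : shiftClass 0 (hi + 1) (stairPerm 0 ((2 * (K + 1) + 1) :: List.replicate c 1)) =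
      Set.range f := by
    ext w
    rw [e, mem_shiftClass_arcCycle_iff hcyc.1 hcyc.2]
    constructor
    · rintro ⟨m, o, l, h1, h2, h3⟩
      rw [List.length_replicate] at h1
      have h4 := h2.fits
      simp only [ArcFits, h1] at h4
      obtain ⟨x, rfl⟩ : ∃ x : Fin (c + 1), m = K + 1 + x := ⟨⟨m - (K + 1), by omega⟩, by simp; omega⟩
      have h5 := hf ⟨x, o, l, h1⟩
      exact ⟨_, h5.1.unique h2 h5.2 h3⟩
    · rintro ⟨x, rfl⟩
      exact ⟨_, _, _, by simp [x.2.2.2], (hf x).1, (hf x).2⟩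
  rw [stairCount, List.sum_cons, List.sum_replicate, smul_eq_mul, mul_one,
    show 2 * (K + 1) + 1 + c = hi + 1 by omega, hrange, ← Nat.card_coe_set_eq,
    Nat.card_range_of_injective hinj, Nat.card_prod, card_side_vector, Nat.card_fin]

/-! ### Collecting the factors -/

/-- The contribution of an even part to the exponent `p`. -/
def twoExponent (x : ℕ) : ℕ := if Even x ∧ 4 ≤ x then 1 else 0

/-- The contribution of an even part to the exponent `q`. -/
def threeExponent (x : ℕ) : ℕ := if Even x ∧ 4 ≤ x then x / 2 - 2 else 0

theorem stairCount_append (l l' : List ℕ) (hl : ∀ x ∈ l, Even x) (hpos : ∀ x ∈ l ++ l', 0 < x) :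
    stairCount (l ++ l') =
      2 ^ (l.map twoExponent).sum * 3 ^ (l.map threeExponent).sum * stairCount l' := by
  induction l with
  | nil => simp
  | cons x l ih =>
    have ih := ih (fun y hy => hl y (by simp [hy])) fun y hy => hpos y (by simp_all)
    have hpos' : ∀ y ∈ l ++ l', 0 < y := fun y hy => hpos y (by simp_all)
    have hx := hl x (by simp)
    have hx0 := hpos x (by simp)
    obtain ⟨k, hk⟩ := hx
    rw [List.cons_append, List.map_cons, List.map_cons, List.sum_cons, List.sum_cons]
    rcases Nat.lt_or_ge x 4 with h4 | h4
    · obtain rfl : x = 2 := by omega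
      rw [stairCount_two_cons hpos', ih]
      simp [twoExponent, threeExponent]
    · obtain ⟨K, rfl⟩ : ∃ K, k = K + 2 := ⟨k - 2, by omega⟩
      obtain rfl : x = 2 * (K + 2) := by omega
      rw [stairCount_even_cons hpos', ih, twoExponent, threeExponent, if_pos ⟨by simp, h4⟩,
        if_pos ⟨by simp, h4⟩, show 2 * (K + 2) / 2 - 2 = K by omega]
      ring

/-- The subtraction in `threeExponent` does not truncate, because only even parts that are at least
4 contribute. -/
theorem sum_threeExponent (l : List ℕ) : ((l.map threeExponent).sum : ℚ) =
    -2 * ((l.map twoExponent).sum : ℚ) +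
      (1 / 2 : ℚ) * (l.map fun x : ℕ => if Even x ∧ 4 ≤ x then (x : ℚ) else 0).sum := by
  induction l with
  | nil => simp
  | cons x l ih =>
    rw [List.map_cons, List.map_cons, List.map_cons, List.sum_cons, List.sum_cons, List.sum_cons,
      Nat.cast_add, ih, Nat.cast_add, threeExponent, twoExponent]
    split_ifs with h
    · obtain ⟨⟨k, rfl⟩, h4⟩ := h
      obtain ⟨K, rfl⟩ : ∃ K, k = K + 2 := ⟨k - 2, by omega⟩
      rw [show (K + 2 + (K + 2)) / 2 - 2 = K by omega]
      push_cast
      ring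
    · push_cast
      ring

theorem sum_blocksFun_eq {n : ℕ} {M : Type*} [AddCommMonoid M] (α : Composition n) (f : ℕ → M) :
    ∑ i, f (α.blocksFun i) = (α.blocks.map f).sum := by
  conv_rhs => rw [← α.ofFn_blocksFun, List.map_ofFn, List.sum_ofFn]
  rfl

end HeckeCenter

theorem mainTheorem10 {n : ℕ} (α : Composition n) (hα : HeckeCenter.IsMaximal α)
    (p : ℕ) (hp : p = (HeckeCenter.largeEvenPositions α).card)
    (n' : ℕ) (hn' : n' = (α.blocks.filter (fun a => Odd a)).sum) :
    ∃ q : ℕ,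
      (q : ℚ) = -2 * (p : ℚ) +
        (1 / 2 : ℚ) * ∑ i ∈ HeckeCenter.largeEvenPositions α, (α.blocksFun i : ℚ) ∧
      (HeckeCenter.stairClass α).ncard =
        2 ^ p * 3 ^ q * (HeckeCenter.stairClass (HeckeCenter.oddParts α)).ncard ∧
      ∀ r : ℕ, HeckeCenter.HasHookForm (HeckeCenter.oddParts α) r →
        (r ≤ 1 → (HeckeCenter.stairClass α).ncard = 2 ^ p * 3 ^ q) ∧
        (3 ≤ r → (HeckeCenter.stairClass α).ncard =
          (n' - r + 1) * 2 ^ (p + 1) * 3 ^ (q + (r - 3) / 2)) := by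
  subst hn'
  have hp' : p = (α.blocks.map HeckeCenter.twoExponent).sum := by
    rw [hp, HeckeCenter.largeEvenPositions, Finset.card_filter, ← HeckeCenter.sum_blocksFun_eq]
    rfl
  obtain ⟨k, -, heven, hodd, -⟩ := hα
  have hblocks := List.take_append_drop k α.blocks
  have hfilter : α.blocks.filter (fun a => Odd a) = α.blocks.drop k := by
    conv_lhs => rw [← hblocks]
    rw [List.filter_append, List.filter_eq_nil_iff.2, List.nil_append, List.filter_eq_self.2]
    · simpa using hodd
    · simpa using heven
  have hblocks' : (HeckeCenter.oddParts α).blocks = α.blocks.filter (fun a => Odd a) := rfl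
  have hsum : ∀ f : ℕ → ℕ, (∀ x, Odd x → f x = 0) →
      (α.blocks.map f).sum = ((α.blocks.take k).map f).sum := by
    intro f hf
    conv_lhs => rw [← hblocks]
    rw [List.map_append, List.sum_append, List.sum_eq_zero (l := (α.blocks.drop k).map f), add_zero]
    intro x hx
    obtain ⟨y, hy, rfl⟩ := List.mem_map.1 hx
    exact hf y (hodd y hy)
  have hcount : (HeckeCenter.stairClass α).ncard = 2 ^ p * 3 ^ (α.blocks.map HeckeCenter.threeExponent).sum *
      (HeckeCenter.stairClass (HeckeCenter.oddParts α)).ncard := by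
    rw [HeckeCenter.ncard_stairClass_eq_stairCount, HeckeCenter.ncard_stairClass_eq_stairCount, hp',
      hsum HeckeCenter.twoExponent fun x hx => if_neg fun h => Nat.not_even_iff_odd.2 hx h.1,
      hsum HeckeCenter.threeExponent fun x hx => if_neg fun h => Nat.not_even_iff_odd.2 hx h.1]
    conv_lhs => rw [← hblocks]
    rw [HeckeCenter.stairCount_append _ _ heven (fun x hx => α.blocks_pos (by rwa [hblocks] at hx)),
      hblocks', hfilter]
  refine ⟨(α.blocks.map HeckeCenter.threeExponent).sum, ?_, hcount, fun r hr => ?_⟩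
  · rw [HeckeCenter.sum_threeExponent, ← hp', HeckeCenter.largeEvenPositions, Finset.sum_filter, ← HeckeCenter.sum_blocksFun_eq]
  rw [hcount, HeckeCenter.ncard_stairClass_eq_stairCount (HeckeCenter.oddParts α)]
  rcases hr with ⟨h1, h2, h3⟩ | ⟨rfl, h3⟩
  · have hr : Odd r := by
      have : r ∈ (HeckeCenter.oddParts α).blocks := by simp [h3]
      rw [hblocks', List.mem_filter] at this
      simpa using this.2
    rw [h3]
    constructor
    · intro hr1
      obtain rfl : r = 1 := by omega
      rw [← List.replicate_succ, HeckeCenter.stairCount_replicate_one, mul_one]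
    · intro hr3
      obtain ⟨j, rfl⟩ := hr
      obtain ⟨K, rfl⟩ : ∃ K, j = K + 1 := ⟨j - 1, by omega⟩
      rw [HeckeCenter.stairCount_hook, show (2 * (K + 1) + 1 - 3) / 2 = K by omega]
      ring
  · rw [h3, ← List.replicate_zero (a := 1), HeckeCenter.stairCount_replicate_one]
    exact ⟨fun _ => mul_one _, fun h => absurd h (by omega)⟩
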